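/- Functions on the circle $\mathbb T=[0,2\pi)$ are identified with $2\pi$-periodic functions on $\mathbb R$, and $W^{1,\infty}(\mathbb T)$ is the space of $2\pi$-periodic Lipschitz functions with the norm $\max(\|u\|_\infty,\|u'\|_\infty)$. Write $e^{i\theta}=(\cos\theta,\sin\theta)\in\mathbb R^2$. For $h\in W^{1,\infty}(\mathbb T)$ that is the support function of a nonempty open convex set, let $\Omega^h$ be this set, so $h(\theta)=\sup\{x\cdot e^{i\theta} : x\in\Omega^h\}$ for all $\theta$. Let $\mathcal S_{ad}$ be a class of open sets in $\mathbb R^2$ and $\widetilde{\mathcal F}_{ad}=\{h\in W^{1,\infty}(\mathbb T) : \Omega^h \text{ exists and } \Omega^h\in\mathcal S_{ad}\}$. Assume that there are an upper semicontinuous $k_1:\mathbb T\to[-\infty,\infty]$ and a lower semicontinuous $k_2:\mathbb T\to[-\infty,\infty]$ such that $$\widetilde{\mathcal F}_{ad}=\{h\in W^{1,\infty}(\mathbb T) : \Omega^h\text{ exists and } k_1\le h\le k_2\}.$$ Let $J=R+C$ be a real-valued functional on $\mathcal S_{ad}$, and let $\Omega_0=\Omega^{h_0}\in\mathcal S_{ad}$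 be optimal for $$\min\{J(\Omega) : \Omega\in\mathcal S_{ad},\ \Omega\text{ convex}\}.$$ Assume that for all $h\in\widetilde{\mathcal F}_{ad}$ $$R(\Omega^h)=r(h),\qquad C(\Omega^h)=\int_{\mathbb T}G(\theta,h(\theta),h'(\theta))\,d\theta,$$ where, for some $p\in[1,\infty]$, and with $\mathrm{Conv}(h_0'(\mathbb T))$ the smallest closed interval containing all the left and right derivatives of $h_0$: i) $r:W^{1,\infty}(\mathbb T)\to\mathbb R$ is $C^1$ around $h_0$, and $G=G(\theta,u,q):\mathbb T\times\mathbb R\times\mathbb R\to\mathbb R$ is $C^2$ around $\mathbb T\times h_0(\mathbb T)\times\mathrm{Conv}(h_0'(\mathbb T))$; ii) $r'(h_0)\in L^p(\mathbb T)$, that is, there is $\rho\in L^p(\mathbb T)$ with $r'(h_0)v=\int_{\mathbb T}\rho v\,d\theta$ for all $v\in W^{1,\infty}(\mathbb T)$; iii) $G_{qq}>0$ on $\mathbb T\times h_0(\mathbb T)\times\mathrm{Conv}(h_0'(\mathbb T))$. Let $\widetilde{\mathbb T_{in}}=\{\theta\in\mathbb T : k_1(\theta)<h_0(\theta)<k_2(\theta)\}$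 and $\widetilde{(\partial\Omega_0)_{in}}=\{x\in\partial\Omega_0 : \exists\,\theta\in\widetilde{\mathbb T_{in}},\ x\cdot e^{i\theta}=h_0(\theta)\}$. Then $$h_0\in W^{2,p}(\widetilde{\mathbb T_{in}}).$$ In particular $\widetilde{(\partial\Omega_0)_{in}}$ is strictly convex: for each $\theta\in\widetilde{\mathbb T_{in}}$ exactly one point $x\in\partial\Omega_0$ satisfies $x\cdot e^{i\theta}=h_0(\theta)$, and $\widetilde{(\partial\Omega_0)_{in}}$ contains no nondegenerate line segment. -/

import Mathlib

open Real Set Filter Topology MeasureTheory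
open scoped ENNReal NNReal ContDiff BoundedContinuousFunction

noncomputable section

namespace SupportShape

/-- The Euclidean plane. -/
abbrev Plane : Type := EuclideanSpace ℝ (Fin 2)

/-! ### The space `W^{1,∞}(𝕋)` of `2π`-periodic Lipschitz functions -/

/-- `2π`-periodic Lipschitz functions on the line, that is, the continuous representatives of the
`2π`-periodic elements of `W^{1,∞}_loc(ℝ)`. -/
def periodicLipschitz : Submodule ℝ (ℝ → ℝ) where
  carrier := {u | Function.Periodic u (2 * π) ∧ ∃ K : ℝ≥0, LipschitzWith K u}
  add_mem' := by
    rintro u v ⟨hu, K, hK⟩ ⟨hv, L, hL⟩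
    exact ⟨hu.add hv, K + L, hK.add hL⟩
  zero_mem' := ⟨fun _ => rfl, 0, LipschitzWith.const 0⟩
  smul_mem' := by
    rintro c u ⟨hu, K, hK⟩
    refine ⟨fun x => ?_, ‖c‖₊ * K, ?_⟩
    · simp [hu x]
    · exact (lipschitzWith_smul c).comp hK

/-- The space `W^{1,∞}(𝕋)`; its norm is `max (‖u‖_∞) (‖u'‖_∞)`, see `W1inf.norm_eq`. -/
def W1inf : Type := periodicLipschitz

namespace W1inf

instance : AddCommGroup W1inf := inferInstanceAs (AddCommGroup periodicLipschitz)

instance : Module ℝ W1inf := inferInstanceAs (Module ℝ periodicLipschitz)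

instance : CoeFun W1inf (fun _ => ℝ → ℝ) := ⟨fun u => u.1⟩

theorem periodic (u : W1inf) : Function.Periodic u (2 * π) := u.2.1

theorem exists_lipschitz (u : W1inf) : ∃ K : ℝ≥0, LipschitzWith K u := u.2.2

theorem continuous (u : W1inf) : Continuous u :=
  u.exists_lipschitz.choose_spec.continuous

theorem exists_bound (u : W1inf) : ∃ C : ℝ, ∀ x, ‖u x‖ ≤ C := by
  obtain ⟨C, hC⟩ := (isCompact_Icc (a := (0 : ℝ)) (b := 0 + 2 * π)).exists_bound_of_continuousOn
    u.continuous.continuousOn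
  refine ⟨C, fun x => ?_⟩
  obtain ⟨y, hy, hxy⟩ := u.periodic.exists_mem_Ico Real.two_pi_pos x 0
  rw [hxy]
  exact hC y (Ico_subset_Icc_self hy)

/-- An element of `W^{1,∞}(𝕋)` as a bounded continuous function. -/
def toBCF (u : W1inf) : ℝ →ᵇ ℝ :=
  BoundedContinuousFunction.ofNormedAddCommGroup u u.continuous u.exists_bound.choose
    u.exists_bound.choose_spec

theorem memLp_deriv (u : W1inf) : MemLp (deriv u) ∞ (volume : Measure ℝ) := by
  obtain ⟨K, hK⟩ := u.exists_lipschitz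
  exact memLp_top_of_bound (measurable_deriv u).aestronglyMeasurable K
    (Eventually.of_forall fun x => norm_deriv_le_of_lipschitz hK)

/-- The linear injection `u ↦ (u, u')`, which carries the norm of `W^{1,∞}(𝕋)`. -/
def jet : W1inf →ₗ[ℝ] (ℝ →ᵇ ℝ) × Lp ℝ ∞ (volume : Measure ℝ) where
  toFun u := (u.toBCF, u.memLp_deriv.toLp (deriv u))
  map_add' u v := by
    refine Prod.ext (by ext x; rfl) ?_
    refine (MemLp.toLp_congr (u + v).memLp_deriv (u.memLp_deriv.add v.memLp_deriv) ?_).trans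
      (MemLp.toLp_add u.memLp_deriv v.memLp_deriv)
    filter_upwards [u.exists_lipschitz.choose_spec.ae_differentiableAt_real,
      v.exists_lipschitz.choose_spec.ae_differentiableAt_real] with x hx hy
    exact deriv_add hx hy
  map_smul' c u := by
    refine Prod.ext (by ext x; rfl) ?_
    refine (MemLp.toLp_congr (c • u).memLp_deriv (u.memLp_deriv.const_smul c) ?_).trans
      (MemLp.toLp_const_smul c u.memLp_deriv)
    filter_upwards [u.exists_lipschitz.choose_spec.ae_differentiableAt_real] with x hx
    exact deriv_const_smul c hx

theorem jet_injective : Function.Injective jet := by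
  intro u v h
  have h1 : u.toBCF = v.toBCF := congrArg Prod.fst h
  refine Subtype.ext (funext fun x => ?_)
  exact DFunLike.congr_fun h1 x

instance : NormedAddCommGroup W1inf :=
  NormedAddCommGroup.induced W1inf ((ℝ →ᵇ ℝ) × Lp ℝ ∞ (volume : Measure ℝ)) jet jet_injective

instance : NormedSpace ℝ W1inf :=
  NormedSpace.induced ℝ W1inf ((ℝ →ᵇ ℝ) × Lp ℝ ∞ (volume : Measure ℝ)) jet

theorem norm_eq (u : W1inf) :
    ‖u‖ = max (⨆ x, ‖u x‖) (eLpNorm (deriv u) ∞ (volume : Measure ℝ)).toReal := by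
  change max ‖u.toBCF‖ ‖u.memLp_deriv.toLp (deriv u)‖ = _
  rw [Lp.norm_toLp, BoundedContinuousFunction.norm_eq_iSup_norm]
  rfl

end W1inf

/-! ### The space `W^{2,p}` on an open periodic subset of the line -/

/-- On the open set `U`, the function `g` is the weak derivative of `f`. -/
def HasWeakDerivOn (f g : ℝ → ℝ) (U : Set ℝ) : Prop :=
  ∀ φ : ℝ → ℝ, ContDiff ℝ ∞ φ → HasCompactSupport φ → tsupport φ ⊆ U →
    ∫ t, f t * deriv φ t = -∫ t, g t * φ t

/-- The `2π`-periodic function `f` is in `L^p(U)`, for a `2π`-periodic set `U`, regarded as a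
subset of the circle. -/
def MemLpPeriodic (f : ℝ → ℝ) (p : ℝ≥0∞) (U : Set ℝ) : Prop :=
  Function.Periodic f (2 * π) ∧ MemLp f p (volume.restrict (U ∩ Ioc 0 (2 * π)))

/-- The `2π`-periodic function `f` is in `W^{2,p}(U)`, for a `2π`-periodic open set `U`, regarded
as a subset of the circle: `f` and its first two weak derivatives on `U` are in `L^p(U)`. -/
def MemW2p (f : ℝ → ℝ) (p : ℝ≥0∞) (U : Set ℝ) : Prop :=
  MemLpPeriodic f p U ∧
    ∃ f₁ f₂ : ℝ → ℝ, MemLpPeriodic f₁ p U ∧ MemLpPeriodic f₂ p U ∧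
      HasWeakDerivOn f f₁ U ∧ HasWeakDerivOn f₁ f₂ U

/-! ### Convex shapes and their support functions -/

/-- The unit vector `e^{iθ}`. -/
def dir (θ : ℝ) : Plane := !₂[Real.cos θ, Real.sin θ]

/-- `Ω = Ω^h`: the set `Ω` is a nonempty open convex set whose support function is `h`, that is,
`h θ = sup {x · e^{iθ} | x ∈ Ω}` for all `θ`. -/
structure IsShape (Ω : Set Plane) (h : W1inf) : Prop where
  nonempty : Ω.Nonempty
  isOpen : IsOpen Ω
  convex : Convex ℝ Ω
  isLUB : ∀ θ, IsLUB ((fun x : Plane => inner ℝ x (dir θ)) '' Ω) (h θ)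

/-- The set of admissible support functions `{h ∈ W^{1,∞}(𝕋) | Ω^h ∈ S}`. -/
def admissible (S : Set (Set Plane)) : Set W1inf :=
  {h | ∃ Ω ∈ S, IsShape Ω h}

/-- `Ω₀` is an optimal shape for `min {J(Ω) | Ω ∈ S, Ω convex}`. -/
def IsOptimalShape (J : Set Plane → ℝ) (S : Set (Set Plane)) (Ω₀ : Set Plane) : Prop :=
  Ω₀ ∈ S ∧ Convex ℝ Ω₀ ∧ ∀ Ω ∈ S, Convex ℝ Ω → J Ω₀ ≤ J Ω

/-- The angles at which the constraints `k₁ ≤ h ≤ k₂` are not saturated. -/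
def freeAngles (k₁ k₂ : ℝ → EReal) (h : ℝ → ℝ) : Set ℝ :=
  {θ | k₁ θ < (h θ : EReal) ∧ (h θ : EReal) < k₂ θ}

/-- The part of `∂Ω` of points having a supporting line with normal `e^{iθ}`, `θ ∈ U`; here `h` is
the support function of `Ω`. -/
def boundaryPart (Ω : Set Plane) (h : ℝ → ℝ) (U : Set ℝ) : Set Plane :=
  {x | x ∈ frontier Ω ∧ ∃ θ ∈ U, inner ℝ x (dir θ) = h θ}

/-! ### The hypotheses on the functional -/

/-- `Conv(u'(𝕋))`: the smallest closed interval that contains all the right and left derivatives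
of `u`. -/
def slopeHull (u : ℝ → ℝ) : Set ℝ :=
  closure (convexHull ℝ
    {d | ∃ θ, HasDerivWithinAt u d (Ioi θ) θ ∨ HasDerivWithinAt u d (Iio θ) θ})

/-- The functional `r` is `C¹` around `u₀` in `W^{1,∞}(𝕋)`, and `r'(u₀) ∈ L^p(𝕋)`. -/
def RegularPart (r : W1inf → ℝ) (u₀ : W1inf) (p : ℝ≥0∞) : Prop :=
  ContDiffAt ℝ 1 r u₀ ∧
    ∃ ρ : ℝ → ℝ, MemLpPeriodic ρ p univ ∧
      ∀ v : W1inf, fderiv ℝ r u₀ v = ∫ θ in 0..(2 * π), ρ θ * v θ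

/-- The integrand `G(θ, u, q)`, `2π`-periodic in `θ`, is `C²` around
`𝕋 × u₀(𝕋) × Conv(u₀'(𝕋))`, and `G_qq > 0` on this set. -/
def ConvexIntegrand (G : ℝ → ℝ → ℝ → ℝ) (u₀ : W1inf) : Prop :=
  (∀ θ u q, G (θ + 2 * π) u q = G θ u q) ∧
    ∀ θ, ∀ u ∈ range u₀, ∀ q ∈ slopeHull u₀,
      ContDiffAt ℝ 2 (fun z : ℝ × ℝ × ℝ => G z.1 z.2.1 z.2.2) (θ, u, q) ∧
        0 < iteratedDeriv 2 (fun s => G θ u s) q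

end SupportShape

end

open SupportShape

noncomputable section

namespace SupportShape

/-! The optimality of `h₀` is tested only against shapes obtained by growing `Ω₀` towards a corner.
For a short free arc `[α, β]`, let `P` be the intersection of the supporting lines with normals
`e^{iα}` and `e^{iβ}`, and let `T θ = ⟨P, e^{iθ}⟩`, the sinusoid that agrees with `h₀` at `α` and
`β`. Sublinearity of support functions gives `T ≥ h₀` on `[α, β]` and `T ≤ h₀` on the rest of the
circle (`support_le_corner`, `corner_le_support`). Hence `v = (T - h₀)⁺` lives on the arc, and `h₀ +
t v` is the support function of `(1 - t) Ω₀ + t conv(Ω₀ ∪ {P})` (`isShape_add_smul_bump`). It is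
admissible for small `t > 0`: it lies above `h₀ ≥ k₁`, and it differs from `h₀` only over a compact
arc where `h₀ < k₂`. So the first variation in the direction `v` is nonnegative
(`optimal_variation_nonneg`).

Let `m` be the slope of the chord of `h₀` over the arc and `L = β - α`. Since `T' = m + O(L)`, while
`v` vanishes at both ends and is bounded by `∫ |h₀' - m| + O(L²)`, the strong monotonicity of `G_q`
in `q` bounds the mean oscillation of the slope: `∫ |h₀' - m| ≤ C L ∫ (|ρ| + 1)` over the arc
(`exists_integral_abs_deriv_sub_slope_le`).

Support functions are semiconvex, so `h₀' + M θ` has a monotone representative. For a monotone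
function, mean oscillation over an interval controls the increment over its middle half
(`middle_half_le_of_mean_oscillation`). Summing over fine partitions, whose doubled intervals
overlap twice, gives `|h₀'(y) - h₀'(x)| ≤ C' ∫ (|ρ| + 1)` over every interval `[x, y]` of free
angles (`exists_deriv_sub_le_integral`). Thus `h₀'` is locally absolutely continuous there and
`|h₀''| ≤ C' (|ρ| + 1)`, which is in `L^p`. Differentiability of `h₀` at free angles is what makes
the contact points unique. -/

/-! ### Sublinearity of support functions and corners -/

theorem inner_dir (x : Plane) (θ : ℝ) :
    inner ℝ x (dir θ) = x 0 * Real.cos θ + x 1 * Real.sin θ := by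
  simp [dir, PiLp.inner_apply, Fin.sum_univ_two, mul_comm]

theorem norm_dir (θ : ℝ) : ‖dir θ‖ = 1 := by
  simp [dir, EuclideanSpace.norm_eq, Fin.sum_univ_two]

theorem inner_le_support {Ω : Set Plane} {h : W1inf} (hs : IsShape Ω h) {x : Plane}
    (hx : x ∈ closure Ω) (θ : ℝ) : inner ℝ x (dir θ) ≤ h θ := by
  have hcl : IsClosed {y : Plane | inner ℝ y (dir θ) ≤ h θ} :=
    isClosed_le (by fun_prop) continuous_const
  exact closure_minimal (fun y hy => (hs.isLUB θ).1 ⟨y, hy, rfl⟩) hcl hx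

/-- Support functions are sublinear. -/
theorem support_subadd {Ω : Set Plane} {h : W1inf} (hs : IsShape Ω h) {r a b θ α β : ℝ}
    (hr : 0 ≤ r) (ha : 0 ≤ a) (hb : 0 ≤ b)
    (hcos : r * Real.cos θ = a * Real.cos α + b * Real.cos β)
    (hsin : r * Real.sin θ = a * Real.sin α + b * Real.sin β) :
    r * h θ ≤ a * h α + b * h β := by
  have key : ∀ x ∈ Ω, r * inner ℝ x (dir θ) ≤ a * h α + b * h β := by
    intro x hx
    have h1 := inner_le_support hs (subset_closure hx) α
    have h2 := inner_le_support hs (subset_closure hx) β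
    have h3 : r * inner ℝ x (dir θ) = a * inner ℝ x (dir α) + b * inner ℝ x (dir β) := by
      simp only [inner_dir]
      linear_combination x 0 * hcos + x 1 * hsin
    rw [h3]
    gcongr
  rcases hr.eq_or_lt with rfl | hr
  · obtain ⟨x, hx⟩ := hs.nonempty
    simpa using key x hx
  · rw [← le_div_iff₀' hr]
    refine (hs.isLUB θ).2 ?_
    rintro _ ⟨x, hx, rfl⟩
    rw [le_div_iff₀' hr]
    exact key x hx

/-- The point where the supporting lines with normals `e^{iα}` and `e^{iβ}` meet. -/
def corner (h : ℝ → ℝ) (α β : ℝ) : Plane :=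
  !₂[(h α * Real.sin β - h β * Real.sin α) / Real.sin (β - α),
    (h β * Real.cos α - h α * Real.cos β) / Real.sin (β - α)]

theorem inner_corner (h : ℝ → ℝ) {α β : ℝ} (hs : Real.sin (β - α) ≠ 0) (θ : ℝ) :
    Real.sin (β - α) * inner ℝ (corner h α β) (dir θ) =
      h α * Real.sin (β - θ) + h β * Real.sin (θ - α) := by
  rw [inner_dir]
  simp only [corner, PiLp.toLp_apply, Matrix.cons_val_zero, Matrix.cons_val_one,
    Matrix.cons_val_fin_one]
  field_simp
  simp only [Real.sin_sub]
  ring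

theorem inner_corner_left (h : ℝ → ℝ) {α β : ℝ} (hs : Real.sin (β - α) ≠ 0) :
    inner ℝ (corner h α β) (dir α) = h α := by
  have := inner_corner h hs α
  rw [sub_self, Real.sin_zero, mul_zero, add_zero, mul_comm] at this
  exact mul_right_cancel₀ hs this

theorem inner_corner_right (h : ℝ → ℝ) {α β : ℝ} (hs : Real.sin (β - α) ≠ 0) :
    inner ℝ (corner h α β) (dir β) = h β := by
  have := inner_corner h hs β
  rw [sub_self, Real.sin_zero, mul_zero, zero_add, mul_comm] at this
  exact mul_right_cancel₀ hs this

/-- For `θ ∈ [α, β]`, `sin(β - α) e^{iθ}` is the combination of `e^{iα}` and `e^{iβ}` with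
coefficients `sin(β - θ)` and `sin(θ - α)`, both nonnegative here. -/
theorem support_le_corner {Ω : Set Plane} {h : W1inf} (hs : IsShape Ω h) {α β θ : ℝ}
    (hαβ : α < β) (hπ : β - α < π) (h1 : α ≤ θ) (h2 : θ ≤ β) :
    h θ ≤ inner ℝ (corner h α β) (dir θ) := by
  have hpos : 0 < Real.sin (β - α) := Real.sin_pos_of_pos_of_lt_pi (by linarith) hπ
  refine le_of_mul_le_mul_left ?_ hpos
  rw [inner_corner h hpos.ne', mul_comm (h α), mul_comm (h β)]
  refine support_subadd hs hpos.le (Real.sin_nonneg_of_nonneg_of_le_pi (by linarith) (by linarith))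
    (Real.sin_nonneg_of_nonneg_of_le_pi (by linarith) (by linarith)) ?_ ?_
  all_goals
    simp only [Real.sin_sub]
    ring

/-- The same linear relation between the three unit vectors is used, but the signs of its
coefficients change with `θ`. Up to `α + π`, `e^{iβ}` lies in the cone of `e^{iα}` and `e^{iθ}`.
Between `α + π` and `β + π`, a nonnegative combination of all three vanishes. Beyond `β + π`,
`e^{iα}` lies in the cone of `e^{iθ}` and `e^{iβ}`. -/
theorem corner_le_support {Ω : Set Plane} {h : W1inf} (hs : IsShape Ω h) {α β θ : ℝ}
    (hαβ : α < β) (hπ : β - α < π) (h1 : β ≤ θ) (h2 : θ ≤ α + 2 * π) :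
    inner ℝ (corner h α β) (dir θ) ≤ h θ := by
  have hpos : 0 < Real.sin (β - α) := Real.sin_pos_of_pos_of_lt_pi (by linarith) hπ
  refine le_of_mul_le_mul_left ?_ hpos
  rw [inner_corner h hpos.ne']
  rcases le_total θ (α + π) with h3 | h3
  · have := support_subadd hs (r := Real.sin (θ - α)) (a := Real.sin (β - α))
      (b := Real.sin (θ - β)) (θ := β) (α := θ) (β := α)
      (Real.sin_nonneg_of_nonneg_of_le_pi (by linarith) (by linarith)) hpos.le
      (Real.sin_nonneg_of_nonneg_of_le_pi (by linarith) (by linarith))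
      (by simp only [Real.sin_sub]; ring) (by simp only [Real.sin_sub]; ring)
    have e : Real.sin (β - θ) = - Real.sin (θ - β) := by rw [← Real.sin_neg]; ring_nf
    rw [e]; linarith
  have e2 : Real.sin (θ - α) = - Real.sin (θ - α - π) := by rw [Real.sin_sub_pi]; ring
  have h4 : 0 ≤ Real.sin (θ - α - π) :=
    Real.sin_nonneg_of_nonneg_of_le_pi (by linarith) (by linarith)
  rw [← neg_eq_iff_eq_neg] at e2
  rcases le_total θ (β + π) with h5 | h5
  -- Here the combination of the three support values is nonnegative because it dominates the same
  -- combination evaluated at a point of `Ω`, which is zero.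
  · obtain ⟨x, hx⟩ := hs.nonempty
    have hx := inner_le_support hs (subset_closure hx)
    have h6 : 0 ≤ Real.sin (θ - β) :=
      Real.sin_nonneg_of_nonneg_of_le_pi (by linarith) (by linarith)
    have e : Real.sin (β - θ) = - Real.sin (θ - β) := by rw [← Real.sin_neg]; ring_nf
    have id : Real.sin (β - α) * inner ℝ x (dir θ) + Real.sin (θ - β) * inner ℝ x (dir α) +
        Real.sin (θ - α - π) * inner ℝ x (dir β) = 0 := by
      rw [← e2, inner_dir, inner_dir, inner_dir]
      simp only [Real.sin_sub]
      ring
    have i1 := mul_le_mul_of_nonneg_left (hx θ) hpos.le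
    have i2 := mul_le_mul_of_nonneg_left (hx α) h6
    have i3 := mul_le_mul_of_nonneg_left (hx β) h4
    rw [e, neg_eq_iff_eq_neg.1 e2]
    linarith
  · have := support_subadd hs (r := Real.sin (β - θ)) (a := Real.sin (β - α))
      (b := - Real.sin (θ - α)) (θ := α) (α := θ) (β := β)
      (by rw [← Real.sin_add_two_pi]
          exact Real.sin_nonneg_of_nonneg_of_le_pi (by linarith) (by linarith)) hpos.le
      (by rw [e2]; exact h4)
      (by simp only [Real.sin_sub]; ring) (by simp only [Real.sin_sub]; ring)
    linarith

/-! ### Competitors: growing a shape towards a point -/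

theorem lipschitz_inner_dir (P : Plane) :
    ∃ K : ℝ≥0, LipschitzWith K fun θ => inner ℝ P (dir θ) := by
  refine ⟨‖P 0‖₊ * 1 + ‖P 1‖₊ * 1, ?_⟩
  simp only [inner_dir]
  exact ((lipschitzWith_smul (P 0)).comp Real.lipschitzWith_cos).add
    ((lipschitzWith_smul (P 1)).comp Real.lipschitzWith_sin)

theorem dir_periodic : Function.Periodic dir (2 * π) := fun θ => by simp [dir]

/-- The function `(⟨P, e^{iθ}⟩ - h)⁺`, by which the support function `h` of `Ω` grows when the
point `P` is added to `Ω`. -/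
def bump (h : W1inf) (P : Plane) : W1inf :=
  ⟨fun θ => max (inner ℝ P (dir θ) - h θ) 0, fun θ => by
      simp only [dir_periodic θ, h.periodic θ], by
      obtain ⟨K, hK⟩ := lipschitz_inner_dir P
      obtain ⟨L, hL⟩ := h.exists_lipschitz
      exact ⟨_, (hK.sub hL).max_const 0⟩⟩

theorem bump_apply (h : W1inf) (P : Plane) (θ : ℝ) :
    bump h P θ = max (inner ℝ P (dir θ) - h θ) 0 := rfl

theorem add_smul_apply (h v : W1inf) (t θ : ℝ) : (h + t • v) θ = h θ + t * v θ := rfl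

/-- Support functions add under Minkowski sums, and that of `conv(Ω ∪ {P})` is `max h ⟨P, ·⟩ = h +
bump h P`. For `t < 1` the sum is open, being a union of translates of the open set `(1 - t) Ω`. -/
theorem isShape_add_smul_bump {Ω : Set Plane} {h : W1inf} (hs : IsShape Ω h) (P : Plane) {t : ℝ}
    (h0 : 0 ≤ t) (h1 : t < 1) :
    IsShape {z | ∃ x ∈ Ω, ∃ y ∈ convexHull ℝ (insert P Ω), (1 - t) • x + t • y = z}
      (h + t • bump h P) where
  nonempty := by
    obtain ⟨x, hx⟩ := hs.nonempty
    exact ⟨_, x, hx, x, subset_convexHull ℝ _ (mem_insert_of_mem _ hx), rfl⟩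
  isOpen := by
    have : {z | ∃ x ∈ Ω, ∃ y ∈ convexHull ℝ (insert P Ω), (1 - t) • x + t • y = z} =
        ⋃ y ∈ convexHull ℝ (insert P Ω), (fun x => (1 - t) • x + t • y) '' Ω := by
      ext z
      simp only [mem_ofPred_eq, mem_iUnion, mem_image, exists_prop]
      grind
    rw [this]
    refine isOpen_biUnion fun y _ => ?_
    have e : (fun x : Plane => (1 - t) • x + t • y) =
        (Homeomorph.addRight (t • y)) ∘ (Homeomorph.smulOfNeZero (1 - t) (by linarith)) := rfl
    rw [e]
    exact (Homeomorph.isOpenMap _).comp (Homeomorph.isOpenMap _) _ hs.isOpen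
  convex := by
    rintro _ ⟨x, hx, y, hy, rfl⟩ _ ⟨x', hx', y', hy', rfl⟩ a b ha hb hab
    refine ⟨a • x + b • x', hs.convex hx hx' ha hb hab, a • y + b • y',
      convex_convexHull ℝ _ hy hy' ha hb hab, ?_⟩
    module
  isLUB := by
    intro θ
    rw [add_smul_apply, bump_apply]
    constructor
    · rintro _ ⟨_, ⟨x, hx, y, hy, rfl⟩, rfl⟩
      have hx := (hs.isLUB θ).1 ⟨x, hx, rfl⟩
      have hy : inner ℝ y (dir θ) ≤ h θ + max (inner ℝ P (dir θ) - h θ) 0 := by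
        have hconv : Convex ℝ {y : Plane | inner ℝ y (dir θ) ≤
            h θ + max (inner ℝ P (dir θ) - h θ) 0} :=
          convex_halfSpace_le ⟨fun x y => inner_add_left _ _ _,
            fun c x => real_inner_smul_left _ _ _⟩ _
        refine convexHull_min ?_ hconv hy
        rintro z (rfl | hz)
        · have := le_max_left (inner ℝ z (dir θ) - h θ) 0
          simp only [mem_ofPred_eq]
          linarith
        · have := le_max_right (inner ℝ P (dir θ) - h θ) 0
          have := (hs.isLUB θ).1 ⟨z, hz, rfl⟩
          simp only [mem_ofPred_eq]
          linarith
      simp only [inner_add_left, real_inner_smul_left]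
      have e1 := mul_le_mul_of_nonneg_left hx (by linarith : 0 ≤ 1 - t)
      have e2 := mul_le_mul_of_nonneg_left hy h0
      simp only at e1
      linarith
    · intro b hb
      have key : ∀ y ∈ insert P Ω, (1 - t) * h θ + t * inner ℝ y (dir θ) ≤ b := by
        intro y hy
        have : h θ ≤ (b - t * inner ℝ y (dir θ)) / (1 - t) := by
          refine (hs.isLUB θ).2 ?_
          rintro _ ⟨x, hx, rfl⟩
          rw [le_div_iff₀' (by linarith)]
          have := hb ⟨_, ⟨x, hx, y, subset_convexHull ℝ _ hy, rfl⟩, rfl⟩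
          simp only [inner_add_left, real_inner_smul_left] at this
          simp only
          linarith
        rw [le_div_iff₀' (by linarith)] at this
        linarith
      rcases h0.eq_or_lt with rfl | h0
      · simpa using key P (mem_insert _ _)
      rcases le_total (inner ℝ P (dir θ) - h θ) 0 with hP | hP
      · rw [max_eq_right hP, mul_zero, add_zero]
        have : h θ ≤ (b - (1 - t) * h θ) / t := by
          refine (hs.isLUB θ).2 ?_
          rintro _ ⟨x, hx, rfl⟩
          rw [le_div_iff₀' h0]
          have := key x (mem_insert_of_mem _ hx)
          simp only
          linarith
        rw [le_div_iff₀' h0] at this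
        linarith
      · rw [max_eq_left hP]
        have := key P (mem_insert _ _)
        linarith

/-! ### Semiconvexity -/

theorem exists_dir_eq (x : Plane) : ∃ θ, inner ℝ x (dir θ) = ‖x‖ := by
  obtain ⟨r, θ, h0, h1⟩ : ∃ r θ : ℝ, x 0 = r * Real.cos θ ∧ x 1 = r * Real.sin θ := by
    let z : ℂ := ⟨x 0, x 1⟩
    refine ⟨‖z‖, z.arg, ?_, ?_⟩
    · exact (Complex.norm_mul_cos_arg z).symm
    · exact (Complex.norm_mul_sin_arg z).symm
  have hr : ‖x‖ = |r| := by
    rw [EuclideanSpace.norm_eq, Fin.sum_univ_two, h0, h1]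
    rw [← Real.sqrt_sq_eq_abs]
    congr 1
    simp only [Real.norm_eq_abs, sq_abs]
    linear_combination r ^ 2 * Real.sin_sq_add_cos_sq θ
  rcases le_total 0 r with h | h
  · refine ⟨θ, ?_⟩
    rw [inner_dir, hr, h0, h1, abs_of_nonneg h]
    linear_combination r * Real.sin_sq_add_cos_sq θ
  · refine ⟨θ + π, ?_⟩
    rw [inner_dir, hr, h0, h1, abs_of_nonpos h, Real.cos_add_pi, Real.sin_add_pi]
    linear_combination - r * Real.sin_sq_add_cos_sq θ

theorem hasDerivAt_inner_dir (P : Plane) (θ : ℝ) :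
    HasDerivAt (fun θ => inner ℝ P (dir θ)) (inner ℝ P (dir (θ + π / 2))) θ := by
  simp only [inner_dir, Real.cos_add_pi_div_two, Real.sin_add_pi_div_two]
  exact ((Real.hasDerivAt_cos θ).const_mul _).add ((Real.hasDerivAt_sin θ).const_mul _)

theorem abs_inner_dir_le (P : Plane) (θ : ℝ) : |inner ℝ P (dir θ)| ≤ ‖P‖ := by
  simpa [norm_dir] using abs_real_inner_le_norm P (dir θ)

/-- Support functions are semiconvex. -/
theorem exists_semiconvex {Ω : Set Plane} {h : W1inf} (hs : IsShape Ω h) :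
    ∃ M : ℝ, 0 ≤ M ∧ ConvexOn ℝ univ fun θ => h θ + M * (θ ^ 2 / 2) := by
  obtain ⟨M, hM⟩ := h.exists_bound
  have hM0 : 0 ≤ M := (norm_nonneg _).trans (hM 0)
  refine ⟨M, hM0, convex_univ, ?_⟩
  -- The second derivative of `θ ↦ ⟨x, e^{iθ}⟩` is at least `-‖x‖ ≥ -M`; convexity then passes to
  -- the supremum over `x ∈ Ω`.
  have key : ∀ x ∈ Ω, ConvexOn ℝ univ fun θ => inner ℝ x (dir θ) + M * (θ ^ 2 / 2) := by
    intro x hx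
    have hxM : ‖x‖ ≤ M := by
      obtain ⟨θ, hθ⟩ := exists_dir_eq x
      rw [← hθ]
      exact (inner_le_support hs (subset_closure hx) θ).trans ((le_abs_self _).trans (hM θ))
    have d1 : ∀ θ, HasDerivAt (fun θ => inner ℝ x (dir θ) + M * (θ ^ 2 / 2))
        (inner ℝ x (dir (θ + π / 2)) + M * θ) θ := by
      intro θ
      convert! (hasDerivAt_inner_dir x θ).add
        (((hasDerivAt_pow 2 θ).div_const 2).const_mul M) using 1
      simp
    have d2 : ∀ θ, HasDerivAt (fun θ => inner ℝ x (dir (θ + π / 2)) + M * θ)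
        (inner ℝ x (dir (θ + π / 2 + π / 2)) + M * 1) θ := fun θ =>
      ((hasDerivAt_inner_dir x (θ + π / 2)).comp_add_const θ (π / 2)).add
        ((hasDerivAt_id θ).const_mul M)
    refine MonotoneOn.convexOn_of_deriv convex_univ
      (fun θ _ => (d1 θ).continuousAt.continuousWithinAt)
      (fun θ _ => (d1 θ).differentiableAt.differentiableWithinAt) ?_
    rw [interior_univ, monotoneOn_univ]
    have : deriv (fun θ => inner ℝ x (dir θ) + M * (θ ^ 2 / 2)) =
        fun θ => inner ℝ x (dir (θ + π / 2)) + M * θ := funext fun θ => (d1 θ).deriv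
    rw [this]
    refine monotone_of_deriv_nonneg (fun θ => (d2 θ).differentiableAt) fun θ => ?_
    rw [(d2 θ).deriv]
    have := neg_le_of_abs_le (abs_inner_dir_le x (θ + π / 2 + π / 2))
    linarith
  intro α _ β _ a b ha hb hab
  simp only [smul_eq_mul]
  have : h (a * α + b * β) ≤ a * (h α + M * (α ^ 2 / 2)) + b * (h β + M * (β ^ 2 / 2)) -
      M * ((a * α + b * β) ^ 2 / 2) := by
    refine (hs.isLUB _).2 ?_
    rintro _ ⟨x, hx, rfl⟩
    have h1 := (key x hx).2 (mem_univ α) (mem_univ β) ha hb hab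
    simp only [smul_eq_mul] at h1
    have h2 := mul_le_mul_of_nonneg_left (inner_le_support hs (subset_closure hx) α) ha
    have h3 := mul_le_mul_of_nonneg_left (inner_le_support hs (subset_closure hx) β) hb
    simp only
    linarith
  linarith

/-! ### Weak derivatives from integral bounds on increments -/

theorem absolutelyContinuousOnInterval_of_abs_sub_le {f Φ : ℝ → ℝ} {a b : ℝ}
    (hΦ : AbsolutelyContinuousOnInterval Φ a b)
    (h : ∀ x y, x ≤ y → |f y - f x| ≤ Φ y - Φ x) : AbsolutelyContinuousOnInterval f a b := by
  refine squeeze_zero (fun E => Finset.sum_nonneg fun i _ => dist_nonneg) (fun E => ?_) hΦ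
  refine Finset.sum_le_sum fun i _ => ?_
  rcases le_total (E.2 i).1 (E.2 i).2 with h1 | h1
  · rw [dist_comm, dist_comm (Φ _), Real.dist_eq, Real.dist_eq]
    exact (h _ _ h1).trans (le_abs_self _)
  · rw [Real.dist_eq, Real.dist_eq]
    exact (h _ _ h1).trans (le_abs_self _)

/-- A bound on small increments of `f` by those of `Φ` is a bound on all increments. -/
theorem abs_sub_le_of_forall_small {f Φ : ℝ → ℝ} {δ : ℝ} (hδ : 0 < δ)
    (h : ∀ x y, x ≤ y → y - x ≤ δ → |f y - f x| ≤ Φ y - Φ x) {x y : ℝ} (hxy : x ≤ y) :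
    |f y - f x| ≤ Φ y - Φ x := by
  obtain ⟨n, hn⟩ := exists_nat_ge ((y - x) / δ)
  have key : ∀ (n : ℕ) (x y : ℝ), x ≤ y → y - x ≤ n * δ → |f y - f x| ≤ Φ y - Φ x := by
    intro n
    induction n with
    | zero =>
      intro x y h1 h2
      exact h x y h1 (by push_cast at h2; linarith)
    | succ n ih =>
      intro x y h1 h2
      push_cast at h2
      rcases le_total (y - x) δ with h3 | h3
      · exact h x y h1 h3
      have e1 := h x (x + δ) (by linarith) (by linarith)
      have e2 := ih (x + δ) y (by linarith) (by linarith)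
      calc |f y - f x| = |(f y - f (x + δ)) + (f (x + δ) - f x)| := by ring_nf
        _ ≤ |f y - f (x + δ)| + |f (x + δ) - f x| := abs_add_le _ _
        _ ≤ Φ y - Φ x := by linarith
  exact key n x y hxy ((div_le_iff₀ hδ).1 hn)

theorem continuousAt_of_abs_sub_le_integral {f F : ℝ → ℝ} {U : Set ℝ} (hU : IsOpen U)
    (hF : ∀ a b, IntervalIntegrable F volume a b)
    (hf : ∀ x y, x ≤ y → Icc x y ⊆ U → |f y - f x| ≤ ∫ t in x..y, F t) {x : ℝ} (hx : x ∈ U) :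
    ContinuousAt f x := by
  obtain ⟨ε, hε, hball⟩ := Metric.isOpen_iff.1 hU x hx
  have hcont : Continuous fun y => ∫ t in x..y, F t := intervalIntegral.continuous_primitive hF x
  have hlim : Tendsto (fun y => |∫ t in x..y, F t|) (𝓝 x) (𝓝 0) := by
    have := (hcont.abs).tendsto x
    simpa using this
  rw [ContinuousAt, tendsto_iff_dist_tendsto_zero]
  refine squeeze_zero' (Eventually.of_forall fun _ => dist_nonneg) ?_ hlim
  filter_upwards [Metric.ball_mem_nhds x hε] with y hy
  have hsub : uIcc x y ⊆ U :=
    ((convex_ball x ε).ordConnected.uIcc_subset (Metric.mem_ball_self hε) hy).trans hball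
  rcases le_total x y with h | h
  · rw [uIcc_of_le h] at hsub
    exact (hf x y h hsub).trans (le_abs_self _)
  · rw [uIcc_of_ge h] at hsub
    rw [dist_comm, intervalIntegral.integral_symm, abs_neg]
    exact (hf y x h hsub).trans (le_abs_self _)

/-- Difference quotients of `f` are dominated by those of a primitive of `F`, which converge almost
everywhere by Lebesgue differentiation. Where `f` is not differentiable, `deriv f` is `0` and the
bound is trivial. -/
theorem abs_deriv_le_of_abs_sub_le_integral {f F : ℝ → ℝ} {U : Set ℝ} (hU : IsOpen U)
    (hF : ∀ a b, IntervalIntegrable F volume a b)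
    (hf : ∀ x y, x ≤ y → Icc x y ⊆ U → |f y - f x| ≤ ∫ t in x..y, F t) :
    ∀ᵐ x, x ∈ U → |deriv f x| ≤ |F x| := by
  have hloc : LocallyIntegrable F volume := by
    rw [locallyIntegrable_iff]
    intro k hk
    obtain ⟨a, ha⟩ := hk.bddBelow
    obtain ⟨b, hb⟩ := hk.bddAbove
    rcases le_total a b with hab | hab
    · exact ((intervalIntegrable_iff_integrableOn_Icc_of_le hab).1 (hF a b)).mono_set
        fun x hx => ⟨ha hx, hb hx⟩
    · exact ((intervalIntegrable_iff_integrableOn_Icc_of_le hab).1 (hF b a)).mono_set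
        fun x hx => ⟨hab.trans (ha hx), (hb hx).trans hab⟩
  filter_upwards [_root_.LocallyIntegrable.ae_hasDerivAt_integral hloc] with x hx hxU
  by_cases hd : DifferentiableAt ℝ f x
  · obtain ⟨ε, hε, hball⟩ := Metric.isOpen_iff.1 hU x hxU
    have h1 := (hasDerivAt_iff_tendsto_slope.1 hd.hasDerivAt).abs
    have h2 := (hasDerivAt_iff_tendsto_slope.1 (hx x)).abs
    refine le_of_tendsto_of_tendsto h1 h2 ?_
    filter_upwards [nhdsWithin_le_nhds (Metric.ball_mem_nhds x hε)] with y hy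
    have hsub : uIcc x y ⊆ U :=
      ((convex_ball x ε).ordConnected.uIcc_subset (Metric.mem_ball_self hε) hy).trans hball
    simp only [slope_def_field, abs_div, intervalIntegral.integral_same, sub_zero]
    refine div_le_div_of_nonneg_right ?_ (abs_nonneg _)
    rcases le_total x y with h | h
    · rw [uIcc_of_le h] at hsub
      exact (hf x y h hsub).trans (le_abs_self _)
    · rw [uIcc_of_ge h] at hsub
      rw [abs_sub_comm, intervalIntegral.integral_symm, abs_neg]
      exact (hf y x h hsub).trans (le_abs_self _)
  · rw [deriv_zero_of_not_differentiableAt hd, abs_zero]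
    exact abs_nonneg _

theorem exists_interval_of_hasCompactSupport {φ : ℝ → ℝ} (hφ : HasCompactSupport φ) :
    ∃ N : ℝ, 0 < N ∧ tsupport φ ⊆ Ioo (-N) N := by
  obtain ⟨N, hN, h⟩ := hφ.isBounded.subset_ball_lt 0 0
  exact ⟨N, hN, by simpa [Real.ball_eq_Ioo] using h⟩

theorem integral_eq_intervalIntegral_of_tsupport {g φ : ℝ → ℝ} {N : ℝ} (hN : 0 < N)
    (hφ : tsupport φ ⊆ Ioo (-N) N) (hg : ∀ x, x ∉ tsupport φ → g x = 0) :
    ∫ t, g t = ∫ t in (-N)..N, g t := by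
  rw [intervalIntegral.integral_of_le (by linarith)]
  refine (setIntegral_eq_integral_of_forall_compl_eq_zero fun x hx => hg x fun h => hx ?_).symm
  exact Ioo_subset_Ioc_self (hφ h)

theorem deriv_eq_zero_of_notMem_tsupport {φ : ℝ → ℝ} {x : ℝ} (hx : x ∉ tsupport φ) :
    deriv φ x = 0 := by
  by_contra h
  exact hx (support_deriv_subset h)

theorem hasWeakDerivOn_deriv_of_lipschitzWith {f : ℝ → ℝ} {K : ℝ≥0} (hf : LipschitzWith K f)
    (U : Set ℝ) : HasWeakDerivOn f (deriv f) U := by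
  intro φ hφ hc _
  obtain ⟨N, hN, hsub⟩ := exists_interval_of_hasCompactSupport hc
  rw [integral_eq_intervalIntegral_of_tsupport hN hsub, integral_eq_intervalIntegral_of_tsupport
    hN hsub, AbsolutelyContinuousOnInterval.integral_mul_deriv_eq_deriv_mul
      hf.lipschitzOnWith.absolutelyContinuousOnInterval
      (hφ.of_le (by norm_cast)).contDiffOn.absolutelyContinuousOnInterval]
  · have h1 : φ N = 0 := image_eq_zero_of_notMem_tsupport fun h => (hsub h).2.false
    have h2 : φ (-N) = 0 := image_eq_zero_of_notMem_tsupport fun h => (hsub h).1.false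
    simp [h1, h2]
  · intro x hx
    rw [image_eq_zero_of_notMem_tsupport hx, mul_zero]
  · intro x hx
    rw [deriv_eq_zero_of_notMem_tsupport hx, mul_zero]

/-- Since `f` is controlled on `U` only, absolute continuity is established for the product `f φ`,
which vanishes off the support of `φ`; its derivative then has zero integral. -/
theorem hasWeakDerivOn_of_abs_sub_le_integral {f F : ℝ → ℝ} {U : Set ℝ} {K : ℝ} (hU : IsOpen U)
    (hF : ∀ a b, IntervalIntegrable F volume a b) (hF0 : ∀ x, 0 ≤ F x) (hm : Measurable f)
    (hK : ∀ x, |f x| ≤ K)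
    (hf : ∀ x y, x ≤ y → Icc x y ⊆ U → |f y - f x| ≤ ∫ t in x..y, F t) :
    HasWeakDerivOn f (deriv f) U := by
  intro φ hφ hc hφU
  have hK0 : 0 ≤ K := (abs_nonneg _).trans (hK 0)
  obtain ⟨N, hN, hsub⟩ := exists_interval_of_hasCompactSupport hc
  have hφ1 : ContDiff ℝ 1 φ := hφ.of_le (by norm_cast)
  obtain ⟨L, hL⟩ := hφ1.lipschitzWith_of_hasCompactSupport hc (by simp)
  obtain ⟨B, hB⟩ := hc.exists_bound_of_continuous hφ1.continuous
  have hB0 : 0 ≤ B := (norm_nonneg _).trans (hB 0)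
  -- An interval of length at most `δ` that meets the support of `φ` stays in `U`; on any other
  -- interval the product has zero increment.
  obtain ⟨δ, hδ, hthick⟩ := hc.isCompact.exists_cthickening_subset_open hU hφU
  set F₁ : ℝ → ℝ := fun t => B * F t + K * L with hF₁
  have hF₁i : ∀ a b, IntervalIntegrable F₁ volume a b := fun a b =>
    ((hF a b).const_mul B).add intervalIntegrable_const
  have hF₁n : ∀ t, 0 ≤ F₁ t := fun t => by
    have := hF0 t
    positivity
  have hincr : ∀ x y, x ≤ y →
      |f y * φ y - f x * φ x| ≤ (∫ t in (-N)..y, F₁ t) - ∫ t in (-N)..x, F₁ t := by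
    intro x y hxy
    refine abs_sub_le_of_forall_small (f := fun x => f x * φ x)
      (Φ := fun y => ∫ t in (-N)..y, F₁ t) hδ ?_ hxy
    intro x y hxy hle
    rw [intervalIntegral.integral_interval_sub_left (hF₁i _ _) (hF₁i _ _)]
    by_cases hint : ∃ z ∈ Icc x y, z ∈ tsupport φ
    · obtain ⟨z, hz, hzφ⟩ := hint
      have hIU : Icc x y ⊆ U := fun w hw => hthick <| by
        refine Metric.mem_cthickening_of_dist_le w z δ _ hzφ ?_
        rw [Real.dist_eq, abs_le]
        constructor <;> linarith [hw.1, hw.2, hz.1, hz.2]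
      have h1 := hf x y hxy hIU
      have h2 : |φ y - φ x| ≤ L * (y - x) := by
        have := hL.dist_le_mul y x
        rwa [Real.dist_eq, Real.dist_eq, abs_of_nonneg (sub_nonneg.2 hxy)] at this
      calc |f y * φ y - f x * φ x| = |(f y - f x) * φ y + f x * (φ y - φ x)| := by ring_nf
        _ ≤ |f y - f x| * |φ y| + |f x| * |φ y - φ x| := by
          rw [← abs_mul, ← abs_mul]; exact abs_add_le _ _
        _ ≤ (∫ t in x..y, F t) * B + K * (L * (y - x)) := by
          gcongr
          · exact (abs_nonneg _).trans h1
          · exact hB y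
          · exact hK x
        _ = ∫ t in x..y, F₁ t := by
          rw [hF₁, intervalIntegral.integral_add ((hF x y).const_mul B) intervalIntegrable_const,
            intervalIntegral.integral_const_mul, intervalIntegral.integral_const, smul_eq_mul]
          ring
    · push Not at hint
      rw [image_eq_zero_of_notMem_tsupport (hint x ⟨le_rfl, hxy⟩),
        image_eq_zero_of_notMem_tsupport (hint y ⟨hxy, le_rfl⟩), mul_zero, mul_zero, sub_zero,
        abs_zero]
      exact intervalIntegral.integral_nonneg hxy fun t _ => hF₁n t
  have hac : AbsolutelyContinuousOnInterval (fun x => f x * φ x) (-N) N :=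
    absolutelyContinuousOnInterval_of_abs_sub_le
      ((hF₁i (-N) N).absolutelyContinuousOnInterval_intervalIntegral (c := -N) (by simp)) hincr
  have hzero : ∫ t in (-N)..N, deriv (fun x => f x * φ x) t = 0 := by
    rw [hac.integral_deriv_eq_sub]
    have h1 : φ N = 0 := image_eq_zero_of_notMem_tsupport fun h => (hsub h).2.false
    have h2 : φ (-N) = 0 := image_eq_zero_of_notMem_tsupport fun h => (hsub h).1.false
    simp [h1, h2]
  -- Only the product is known to be differentiable almost everywhere. Where `φ ≠ 0`, dividing by
  -- `φ` makes `f` differentiable. At a zero of `φ` in `U`, continuity of `f` suffices for the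
  -- product rule. Outside `U` everything vanishes nearby.
  have hderiv : ∀ᵐ x, x ∈ uIoc (-N) N →
      deriv (fun x => f x * φ x) x = deriv f x * φ x + f x * deriv φ x := by
    filter_upwards [hac.ae_differentiableAt] with x hx hxN
    have hψ := hx (uIoc_subset_uIcc hxN)
    have hφx : HasDerivAt φ (deriv φ x) x := (hφ1.differentiable (by simp) x).hasDerivAt
    by_cases h0 : φ x = 0
    · by_cases hxU : x ∈ U
      · rw [h0, mul_zero, zero_add]
        refine HasDerivAt.deriv ?_
        have hc := continuousAt_of_abs_sub_le_integral hU hF hf hxU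
        rw [hasDerivAt_iff_tendsto_slope] at hφx ⊢
        refine ((hc.tendsto.mono_left nhdsWithin_le_nhds).mul hφx).congr fun y => ?_
        simp only [slope_def_field, h0]
        ring
      · have hn : x ∉ tsupport φ := fun h => hxU (hφU h)
        rw [h0, deriv_eq_zero_of_notMem_tsupport hn, mul_zero, mul_zero, add_zero]
        have : (fun x => f x * φ x) =ᶠ[𝓝 x] fun _ => 0 := by
          filter_upwards [notMem_tsupport_iff_eventuallyEq.1 hn] with y hy
          simp [hy]
        rw [this.deriv_eq, deriv_const]
    · have hfx : DifferentiableAt ℝ f x := by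
        refine (hψ.div hφx.differentiableAt h0).congr_of_eventuallyEq ?_
        filter_upwards [hφ1.continuous.continuousAt.eventually_ne h0] with y hy
        simp [hy]
      exact (hfx.hasDerivAt.mul hφx).deriv
  have hi1 : IntervalIntegrable (fun t => f t * deriv φ t) volume (-N) N := by
    refine IntervalIntegrable.mul_continuousOn ?_ (hφ1.continuous_deriv le_rfl).continuousOn
    refine (intervalIntegrable_const (c := K)).mono_fun hm.aestronglyMeasurable ?_
    refine Eventually.of_forall fun t => ?_
    simpa [abs_of_nonneg hK0] using hK t
  have hi2 : IntervalIntegrable (fun t => deriv f t * φ t) volume (-N) N := by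
    refine (hac.intervalIntegrable_deriv.sub hi1).congr_ae ?_
    rw [EventuallyEq, ae_restrict_iff' measurableSet_uIoc]
    filter_upwards [hderiv] with x hx hxN
    rw [hx hxN]
    ring
  rw [integral_eq_intervalIntegral_of_tsupport hN hsub, integral_eq_intervalIntegral_of_tsupport
    hN hsub]
  · rw [intervalIntegral.integral_congr_ae hderiv, intervalIntegral.integral_add hi2 hi1] at hzero
    linarith
  · intro x hx
    rw [image_eq_zero_of_notMem_tsupport hx, mul_zero]
  · intro x hx
    rw [deriv_eq_zero_of_notMem_tsupport hx, mul_zero]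

/-! ### Uniform regularity and convexity of the integrand -/

theorem abs_le_of_hasDerivWithinAt {u : ℝ → ℝ} {K : ℝ≥0} (hu : LipschitzWith K u) {d θ : ℝ}
    {s : Set ℝ} [NeBot (𝓝[s \ {θ}] θ)] (h : HasDerivWithinAt u d s θ) : |d| ≤ K := by
  refine le_of_tendsto (hasDerivWithinAt_iff_tendsto_slope.1 h).abs
    (Eventually.of_forall fun y => ?_)
  rw [slope_def_field, abs_div]
  have := hu.dist_le_mul y θ
  rw [Real.dist_eq, Real.dist_eq] at this
  exact div_le_of_le_mul₀ (abs_nonneg _) K.2 this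

theorem isBounded_slopeHull {u : ℝ → ℝ} {K : ℝ≥0} (hu : LipschitzWith K u) :
    slopeHull u ⊆ Icc (-K : ℝ) K := by
  refine closure_minimal (convexHull_min ?_ (convex_Icc _ _)) isClosed_Icc
  rintro d ⟨θ, h | h⟩
  · have : NeBot (𝓝[Ioi θ \ {θ}] θ) := by
      rw [sdiff_singleton_eq_self (by simp)]; infer_instance
    exact abs_le.1 (abs_le_of_hasDerivWithinAt hu h)
  · have : NeBot (𝓝[Iio θ \ {θ}] θ) := by
      rw [sdiff_singleton_eq_self (by simp)]; infer_instance
    exact abs_le.1 (abs_le_of_hasDerivWithinAt hu h)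

theorem isCompact_slopeHull (u : W1inf) : IsCompact (slopeHull u) := by
  obtain ⟨K, hK⟩ := u.exists_lipschitz
  exact isCompact_Icc.of_isClosed_subset isClosed_closure (isBounded_slopeHull hK)

theorem convex_slopeHull (u : ℝ → ℝ) : Convex ℝ (slopeHull u) :=
  (convex_convexHull ℝ _).closure

theorem deriv_mem_slopeHull {u : ℝ → ℝ} {θ : ℝ} (h : DifferentiableAt ℝ u θ) :
    deriv u θ ∈ slopeHull u :=
  subset_closure (subset_convexHull ℝ _ ⟨θ, Or.inl h.hasDerivAt.hasDerivWithinAt⟩)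

theorem isCompact_range (u : W1inf) : IsCompact (range u) :=
  u.periodic.compact_of_continuous Real.two_pi_pos.ne' u.continuous

theorem convex_range (u : W1inf) : Convex ℝ (range u) :=
  Real.convex_iff_isPreconnected.2 (isPreconnected_range u.continuous)

/-- The set `𝕋 × u(𝕋) × Conv(u'(𝕋))`. -/
def jetRange (u : W1inf) : Set (ℝ × ℝ × ℝ) := univ ×ˢ range u ×ˢ slopeHull u

theorem mem_jetRange {u : W1inf} {z : ℝ × ℝ × ℝ} :
    z ∈ jetRange u ↔ z.2.1 ∈ range u ∧ z.2.2 ∈ slopeHull u := by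
  simp [jetRange, mem_prod]

theorem convex_jetRange (u : W1inf) : Convex ℝ (jetRange u) :=
  convex_univ.prod ((convex_range u).prod (convex_slopeHull u))

theorem exists_zsmul_mem {u : W1inf} {z : ℝ × ℝ × ℝ} (hz : z ∈ jetRange u) :
    ∃ n : ℤ, z - n • ((2 * π, 0, 0) : ℝ × ℝ × ℝ) ∈ Icc 0 (2 * π) ×ˢ range u ×ˢ slopeHull u := by
  obtain ⟨n, hn, -⟩ := existsUnique_sub_zsmul_mem_Ico Real.two_pi_pos z.1 0
  refine ⟨n, ⟨?_, ?_⟩⟩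
  · rw [zero_add] at hn
    exact Ico_subset_Icc_self (by simpa using hn)
  · simpa using (mem_jetRange.1 hz)

/-- Uniform regularity of a periodic function near `𝕋 × u(𝕋) × Conv(u'(𝕋))`. -/
structure UniformIntegrand (g : ℝ × ℝ × ℝ → ℝ) (u : W1inf) (Λ c δ : ℝ) : Prop where
  contDiffAt : ∀ z ∈ jetRange u, ∀ w, dist w z ≤ δ → ContDiffAt ℝ 2 g w
  abs_le : ∀ z ∈ jetRange u, |g z| ≤ Λ
  norm_fderiv_le : ∀ z ∈ jetRange u, ∀ w, dist w z ≤ δ → ‖fderiv ℝ g w‖ ≤ Λ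
  norm_fderiv_sub_le : ∀ z ∈ jetRange u, ∀ w ∈ jetRange u,
    ‖fderiv ℝ g w - fderiv ℝ g z‖ ≤ Λ * ‖w - z‖
  monotone : ∀ θ, ∀ v ∈ range u, ∀ q ∈ slopeHull u, ∀ s ∈ slopeHull u,
    c * (q - s) ^ 2 ≤ (fderiv ℝ g (θ, v, q) (0, 0, 1) - fderiv ℝ g (θ, v, s) (0, 0, 1)) * (q - s)

theorem hasDerivAt_vertical (θ v q : ℝ) :
    HasDerivAt (fun s : ℝ => ((θ, v, s) : ℝ × ℝ × ℝ)) (0, 0, 1) q :=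
  (hasDerivAt_const q θ).prodMk ((hasDerivAt_const q v).prodMk (hasDerivAt_id q))

theorem hasFDerivAt_fderiv_of_contDiffAt {g : ℝ × ℝ × ℝ → ℝ} {z : ℝ × ℝ × ℝ}
    (h : ContDiffAt ℝ 2 g z) : HasFDerivAt (fderiv ℝ g) (fderiv ℝ (fderiv ℝ g) z) z :=
  ((h.fderiv_right (m := 1) (by norm_num)).differentiableAt (by simp)).hasFDerivAt

theorem hasDerivAt_fderiv_vertical {g : ℝ × ℝ × ℝ → ℝ} {θ v q : ℝ}
    (h : ContDiffAt ℝ 2 g (θ, v, q)) :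
    HasDerivAt (fun s => fderiv ℝ g (θ, v, s) (0, 0, 1))
      (fderiv ℝ (fderiv ℝ g) (θ, v, q) (0, 0, 1) (0, 0, 1)) q := by
  have h1 := (hasFDerivAt_fderiv_of_contDiffAt h).comp_hasDerivAt q (hasDerivAt_vertical θ v q)
  simpa using h1.clm_apply (hasDerivAt_const q ((0, 0, 1) : ℝ × ℝ × ℝ))

theorem iteratedDeriv_two_vertical {g : ℝ × ℝ × ℝ → ℝ} {θ v q : ℝ}
    (h : ContDiffAt ℝ 2 g (θ, v, q)) :
    iteratedDeriv 2 (fun s => g (θ, v, s)) q =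
      fderiv ℝ (fderiv ℝ g) (θ, v, q) (0, 0, 1) (0, 0, 1) := by
  rw [iteratedDeriv_succ, iteratedDeriv_one, ← (hasDerivAt_fderiv_vertical h).deriv]
  refine EventuallyEq.deriv_eq ?_
  have h1 : ∀ᶠ s in 𝓝 q, ContDiffAt ℝ 2 g (θ, v, s) :=
    (hasDerivAt_vertical θ v q).continuousAt.eventually (h.eventually (by simp))
  filter_upwards [h1] with s hs
  exact ((hs.differentiableAt (by simp)).hasFDerivAt.comp_hasDerivAt s
    (hasDerivAt_vertical θ v s)).deriv

/-- Periodicity in `θ` reduces all bounds to a compact set. Convexity of `jetRange u` turns the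
bound on the second derivative into a Lipschitz bound on the first, and the positive lower bound `c`
of `G_qq` into strong monotonicity of `G_q`. -/
theorem exists_uniformIntegrand {G : ℝ → ℝ → ℝ → ℝ} {u : W1inf} (hG : ConvexIntegrand G u) :
    ∃ Λ c δ : ℝ, 0 ≤ Λ ∧ 0 < c ∧ 0 < δ ∧
      UniformIntegrand (fun z => G z.1 z.2.1 z.2.2) u Λ c δ := by
  set g : ℝ × ℝ × ℝ → ℝ := fun z => G z.1 z.2.1 z.2.2 with hg
  obtain ⟨hper, hreg⟩ := hG
  have hC2 : ∀ z ∈ jetRange u, ContDiffAt ℝ 2 g z := fun z hz =>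
    (hreg z.1 z.2.1 (mem_jetRange.1 hz).1 z.2.2 (mem_jetRange.1 hz).2).1
  have hpos : ∀ z ∈ jetRange u, 0 < fderiv ℝ (fderiv ℝ g) z (0, 0, 1) (0, 0, 1) := by
    rintro ⟨θ, v, q⟩ hz
    rw [← iteratedDeriv_two_vertical (hC2 _ hz)]
    exact (hreg θ v (mem_jetRange.1 hz).1 q (mem_jetRange.1 hz).2).2
  set c₀ : ℝ × ℝ × ℝ := (2 * π, 0, 0) with hc₀
  have hgp : Function.Periodic g c₀ := fun z => by simp [hg, hc₀, hper]
  have hshift : ∀ n : ℤ, g = fun z => g (z - n • c₀) := fun n =>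
    funext fun z => ((hgp.zsmul n).sub_eq z).symm
  have hd1 : ∀ (n : ℤ) z, fderiv ℝ g (z - n • c₀) = fderiv ℝ g z := by
    intro n z
    conv_rhs => rw [hshift n]
    rw [fderiv_comp_sub]
  have hd2 : ∀ (n : ℤ) z, fderiv ℝ (fderiv ℝ g) (z - n • c₀) = fderiv ℝ (fderiv ℝ g) z := by
    intro n z
    have : fderiv ℝ g = fun z => fderiv ℝ g (z - n • c₀) := funext fun z => (hd1 n z).symm
    conv_rhs => rw [this]
    rw [fderiv_comp_sub]
  set K : Set (ℝ × ℝ × ℝ) := Icc 0 (2 * π) ×ˢ range u ×ˢ slopeHull u with hK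
  have hKc : IsCompact K := isCompact_Icc.prod ((isCompact_range u).prod (isCompact_slopeHull u))
  have hKQ : K ⊆ jetRange u := fun z hz => mem_jetRange.2 hz.2
  have hcont1 : ContinuousOn (fderiv ℝ g) K := fun z hz =>
    (hasFDerivAt_fderiv_of_contDiffAt (hC2 z (hKQ hz))).continuousAt.continuousWithinAt
  have hcont2 : ContinuousOn (fderiv ℝ (fderiv ℝ g)) K := fun z hz =>
    (((hC2 z (hKQ hz)).fderiv_right (m := 1) (by norm_num)).fderiv_right (m := 0)
      (by norm_num)).continuousAt.continuousWithinAt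
  obtain ⟨Λ₀, hΛ₀⟩ := hKc.exists_bound_of_continuousOn (f := g)
    fun z hz => (hC2 z (hKQ hz)).continuousAt.continuousWithinAt
  obtain ⟨Λ₁, hΛ₁⟩ := hKc.exists_bound_of_continuousOn hcont1
  obtain ⟨Λ₂, hΛ₂⟩ : ∃ Λ₂, ∀ z ∈ K, ‖fderiv ℝ (fderiv ℝ g) z‖ ≤ Λ₂ := by
    have hn : ContinuousOn (fun z => ‖fderiv ℝ (fderiv ℝ g) z‖) K := fun z hz =>
      ((((hC2 z (hKQ hz)).fderiv_right (m := 1) (by norm_num)).fderiv_right (m := 0)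
        (by norm_num)).continuousAt.norm).continuousWithinAt
    obtain ⟨b, hb⟩ := hKc.bddAbove_image hn
    exact ⟨b, fun z hz => hb ⟨z, hz, rfl⟩⟩
  obtain ⟨c, hc, hcK⟩ := hKc.exists_forall_le' (a := 0)
    ((hcont2.clm_apply continuousOn_const).clm_apply continuousOn_const)
    (fun z hz => hpos z (hKQ hz))
  -- Competitors have jets slightly outside `jetRange u`, so regularity and the bound, with slack
  -- `1`, are extended to a uniform `δ`-neighbourhood.
  have hV : {w | ContDiffAt ℝ 2 g w ∧ ‖fderiv ℝ g w‖ < Λ₁ + 1} ∈ 𝓝ˢ K := by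
    rw [mem_nhdsSet_iff_forall]
    intro z hz
    have h2 := hC2 z (hKQ hz)
    have h1 := (hasFDerivAt_fderiv_of_contDiffAt h2).continuousAt.norm.eventually_lt
      continuousAt_const ((hΛ₁ z hz).trans_lt (lt_add_one _))
    exact (h2.eventually (by simp)).and h1
  obtain ⟨V, hVo, hKV, hVsub⟩ := mem_nhdsSet_iff_exists.1 hV
  obtain ⟨δ, hδ, hthick⟩ := hKc.exists_cthickening_subset_open hVo hKV
  have hnear : ∀ z ∈ jetRange u, ∀ w, dist w z ≤ δ →
      ContDiffAt ℝ 2 g w ∧ ‖fderiv ℝ g w‖ < Λ₁ + 1 := by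
    intro z hz w hw
    obtain ⟨n, hn⟩ := exists_zsmul_mem hz
    have h1 := hVsub (hthick (Metric.mem_cthickening_of_dist_le (w - n • c₀) _ δ K hn
      (by rwa [dist_sub_right])))
    refine ⟨?_, by rw [← hd1 n w]; exact h1.2⟩
    rw [hshift n]
    exact h1.1.comp w (contDiff_id.sub contDiff_const).contDiffAt
  refine ⟨max (Λ₁ + 1) (max Λ₂ (max Λ₀ 0)), c, δ,
    (le_max_right _ _).trans ((le_max_right _ _).trans (le_max_right _ _)), hc, hδ,
    fun z hz w hw => (hnear z hz w hw).1, fun z hz => ?_,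
    fun z hz w hw => (hnear z hz w hw).2.le.trans (le_max_left _ _), fun z hz w hw => ?_,
    fun θ v hv => ?_⟩
  · obtain ⟨n, hn⟩ := exists_zsmul_mem hz
    have := congrFun (hshift n) z
    rw [this]
    exact (hΛ₀ _ hn).trans
      ((le_max_left _ _).trans ((le_max_right _ _).trans (le_max_right _ _)))
  · refine (convex_jetRange u).norm_image_sub_le_of_norm_fderiv_le (𝕜 := ℝ)
      (fun x hx => (hasFDerivAt_fderiv_of_contDiffAt (hC2 x hx)).differentiableAt)
      (fun x hx => ?_) hz hw
    obtain ⟨n, hn⟩ := exists_zsmul_mem hx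
    rw [← hd2 n]
    exact (hΛ₂ _ hn).trans ((le_max_left _ _).trans (le_max_right _ _))
  · have hlow : ∀ q ∈ slopeHull u, ∀ s ∈ slopeHull u, s ≤ q →
        c * (q - s) ≤ fderiv ℝ g (θ, v, q) (0, 0, 1) - fderiv ℝ g (θ, v, s) (0, 0, 1) := by
      intro q hq s hs hsq
      have hsub : Icc s q ⊆ slopeHull u := (convex_slopeHull u).ordConnected.out hs hq
      have hd : ∀ x ∈ Icc s q, HasDerivAt (fun s => fderiv ℝ g (θ, v, s) (0, 0, 1))
          (fderiv ℝ (fderiv ℝ g) (θ, v, x) (0, 0, 1) (0, 0, 1)) x := fun x hx =>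
        hasDerivAt_fderiv_vertical (hC2 _ (mem_jetRange.2 ⟨hv, hsub hx⟩))
      refine (convex_Icc s q).mul_sub_le_image_sub_of_le_deriv
        (fun x hx => (hd x hx).continuousAt.continuousWithinAt)
        (fun x hx => (hd x (interior_subset hx)).differentiableAt.differentiableWithinAt)
        (fun x hx => ?_) s ⟨le_rfl, hsq⟩ q ⟨hsq, le_rfl⟩ hsq
      have hx := interior_subset hx
      rw [(hd x hx).deriv]
      obtain ⟨n, hn⟩ := exists_zsmul_mem (u := u) (z := (θ, v, x)) (mem_jetRange.2 ⟨hv, hsub hx⟩)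
      rw [← hd2 n]
      exact hcK _ hn
    intro q hq s hs
    rcases le_total s q with h | h
    · have := mul_le_mul_of_nonneg_right (hlow q hq s hs h) (sub_nonneg.2 h)
      linarith
    · have := mul_le_mul_of_nonneg_right (hlow s hs q hq h) (sub_nonneg.2 h)
      linarith

/-! ### First variation of the integral functional -/

/-- The 1-jet of `u` at `θ`. -/
def jetAt (u : ℝ → ℝ) (θ : ℝ) : ℝ × ℝ × ℝ := (θ, u θ, deriv u θ)

theorem ae_differentiableAt (u : W1inf) : ∀ᵐ θ, DifferentiableAt ℝ u θ :=
  u.exists_lipschitz.choose_spec.ae_differentiableAt_real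

theorem jetAt_mem {u : W1inf} {θ : ℝ} (h : DifferentiableAt ℝ u θ) : jetAt u θ ∈ jetRange u :=
  mem_jetRange.2 ⟨⟨θ, rfl⟩, deriv_mem_slopeHull h⟩

theorem measurable_jetAt (u : W1inf) : Measurable (jetAt u) :=
  measurable_id.prodMk (u.continuous.measurable.prodMk (measurable_deriv u))

/-- Nothing is known of `g` away from the points of regularity, but these form an open set on which
`g` is continuous, so `g` cut off to this set is measurable. -/
theorem aestronglyMeasurable_comp_of_contDiffAt {g : ℝ × ℝ × ℝ → ℝ} {z : ℝ → ℝ × ℝ × ℝ}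
    (hz : Measurable z) (h : ∀ᵐ θ, ContDiffAt ℝ 2 g (z θ)) :
    AEStronglyMeasurable (fun θ => g (z θ)) := by
  set V : Set (ℝ × ℝ × ℝ) := {w | ContDiffAt ℝ 2 g w}
  have hV : IsOpen V := isOpen_iff_mem_nhds.2 fun w (hw : ContDiffAt ℝ 2 g w) =>
    hw.eventually (by simp)
  have hm : Measurable (V.indicator g) := by
    classical
    rw [← piecewise_eq_indicator]
    exact ContinuousOn.measurable_piecewise
      (fun w (hw : ContDiffAt ℝ 2 g w) => hw.continuousAt.continuousWithinAt) continuousOn_const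
      hV.measurableSet
  refine (hm.comp hz).aestronglyMeasurable.congr ?_
  filter_upwards [h] with θ hθ
  exact indicator_of_mem (s := V) hθ g

/-- The density of the first variation of `∫ g(θ, u, u')` at `u` in the direction `v`. -/
def variationDensity (g : ℝ × ℝ × ℝ → ℝ) (u v : ℝ → ℝ) (θ : ℝ) : ℝ :=
  fderiv ℝ g (jetAt u θ) (0, 1, 0) * v θ + fderiv ℝ g (jetAt u θ) (0, 0, 1) * deriv v θ

theorem norm_vert_u : ‖((0, 1, 0) : ℝ × ℝ × ℝ)‖ = 1 := by simp [Prod.norm_def]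

theorem norm_vert_q : ‖((0, 0, 1) : ℝ × ℝ × ℝ)‖ = 1 := by simp [Prod.norm_def]

theorem abs_fderiv_vert_u_le {g : ℝ × ℝ × ℝ → ℝ} {w : ℝ × ℝ × ℝ} {Λ : ℝ}
    (h : ‖fderiv ℝ g w‖ ≤ Λ) : |fderiv ℝ g w (0, 1, 0)| ≤ Λ := by
  have := (fderiv ℝ g w).le_opNorm (0, 1, 0)
  rw [norm_vert_u, mul_one] at this
  exact this.trans h

theorem abs_fderiv_vert_q_le {g : ℝ × ℝ × ℝ → ℝ} {w : ℝ × ℝ × ℝ} {Λ : ℝ}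
    (h : ‖fderiv ℝ g w‖ ≤ Λ) : |fderiv ℝ g w (0, 0, 1)| ≤ Λ := by
  have := (fderiv ℝ g w).le_opNorm (0, 0, 1)
  rw [norm_vert_q, mul_one] at this
  exact this.trans h

theorem hasDerivAt_integral_jet {g : ℝ × ℝ × ℝ → ℝ} {u : W1inf} {Λ c δ : ℝ} (hδ : 0 < δ)
    (hg : UniformIntegrand g u Λ c δ) (v : W1inf) :
    IntervalIntegrable (variationDensity g u v) volume 0 (2 * π) ∧
    HasDerivAt (fun t : ℝ => ∫ θ in 0..(2 * π), g (jetAt (u + t • v : W1inf) θ))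
      (∫ θ in 0..(2 * π), variationDensity g u v θ) 0 := by
  obtain ⟨B₀, hB₀⟩ := v.exists_bound
  obtain ⟨L, hL⟩ := v.exists_lipschitz
  -- `B` bounds `v` and `v'`, and is positive so that `|t| < δ / B` keeps the perturbed jet within
  -- `δ` of the jet of `u`.
  set B : ℝ := max B₀ L + 1 with hB
  have hLB : (L : ℝ) ≤ B := (le_max_right _ _).trans (le_add_of_nonneg_right zero_le_one)
  have hB0 : 0 < B := by
    have : (0 : ℝ) ≤ L := L.2
    linarith [le_max_right B₀ L]
  have hvB : ∀ θ, |v θ| ≤ B := fun θ =>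
    (hB₀ θ).trans ((le_max_left _ _).trans (le_add_of_nonneg_right zero_le_one))
  have hdB : ∀ θ, |deriv v θ| ≤ B := fun θ => (norm_deriv_le_of_lipschitz hL).trans hLB
  let z : ℝ → ℝ → ℝ × ℝ × ℝ := fun t θ => (θ, u θ + t * v θ, deriv u θ + t * deriv v θ)
  have hz0 : ∀ θ, z 0 θ = jetAt u θ := fun θ => by simp [z, jetAt]
  have hzm : ∀ t, Measurable (z t) := fun t =>
    measurable_id.prodMk ((u.continuous.measurable.add (v.continuous.measurable.const_mul t)).prodMk
      ((measurable_deriv u).add ((measurable_deriv v).const_mul t)))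
  have hdist : ∀ t θ, |t| < δ / B → dist (z t θ) (jetAt u θ) ≤ δ := by
    intro t θ ht
    have htB : |t| * B ≤ δ := ((lt_div_iff₀ hB0).1 ht).le
    have h1 : |t * v θ| ≤ δ := by
      rw [abs_mul]; exact (mul_le_mul_of_nonneg_left (hvB θ) (abs_nonneg _)).trans htB
    have h2 : |t * deriv v θ| ≤ δ := by
      rw [abs_mul]; exact (mul_le_mul_of_nonneg_left (hdB θ) (abs_nonneg _)).trans htB
    simp only [z, jetAt, Prod.dist_eq, Real.dist_eq, sub_self, abs_zero, add_sub_cancel_left]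
    exact max_le hδ.le (max_le h1 h2)
  have hs : {t : ℝ | |t| < δ / B} ∈ 𝓝 (0 : ℝ) := by
    have := Metric.ball_mem_nhds (0 : ℝ) (div_pos hδ hB0)
    simpa [Metric.ball, Real.dist_eq] using this
  have hu := ae_differentiableAt u
  have hv := ae_differentiableAt v
  have hder : ∀ θ, DifferentiableAt ℝ u θ → ∀ t, |t| < δ / B →
      HasDerivAt (fun t => g (z t θ)) (fderiv ℝ g (z t θ) (0, 1, 0) * v θ +
        fderiv ℝ g (z t θ) (0, 0, 1) * deriv v θ) t := by
    intro θ hθ t ht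
    have h1 : HasDerivAt (fun t => z t θ) (0, v θ, deriv v θ) t := by
      have h2 := ((hasDerivAt_id t).mul_const (v θ)).const_add (u θ)
      have h3 := ((hasDerivAt_id t).mul_const (deriv v θ)).const_add (deriv u θ)
      simp only [one_mul, id] at h2 h3
      exact (hasDerivAt_const t θ).prodMk (h2.prodMk h3)
    have h4 := ((hg.contDiffAt _ (jetAt_mem hθ) _ (hdist t θ ht)).differentiableAt
      (by simp)).hasFDerivAt.comp_hasDerivAt t h1
    have : ((0, v θ, deriv v θ) : ℝ × ℝ × ℝ) =
        v θ • ((0, 1, 0) : ℝ × ℝ × ℝ) + deriv v θ • ((0, 0, 1) : ℝ × ℝ × ℝ) := by simp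
    rw [this, map_add, map_smul, map_smul, smul_eq_mul, smul_eq_mul, mul_comm (v θ),
      mul_comm (deriv v θ)] at h4
    exact h4
  have hmain := intervalIntegral.hasDerivAt_integral_of_dominated_loc_of_deriv_le
    (μ := volume) (a := 0) (b := 2 * π) (F := fun t θ => g (z t θ)) (x₀ := (0 : ℝ))
    (F' := fun t θ => fderiv ℝ g (z t θ) (0, 1, 0) * v θ +
        fderiv ℝ g (z t θ) (0, 0, 1) * deriv v θ)
    (bound := fun _ => Λ * B + Λ * B) hs ?_ ?_ ?_ ?_ intervalIntegrable_const ?_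
  · have hF0 : (fun θ => fderiv ℝ g (z 0 θ) (0, 1, 0) * v θ +
        fderiv ℝ g (z 0 θ) (0, 0, 1) * deriv v θ) = variationDensity g u v := by
      funext θ
      rw [hz0, variationDensity]
    rw [hF0] at hmain
    refine ⟨hmain.1, ?_⟩
    have hFt : (fun t : ℝ => ∫ θ in 0..(2 * π), g (jetAt (u + t • v : W1inf) θ)) =
        fun t => ∫ θ in 0..(2 * π), g (z t θ) := by
      funext t
      refine intervalIntegral.integral_congr_ae ?_
      filter_upwards [hu, hv] with θ h1 h2 _
      congr 1
      have : deriv (u + t • v : W1inf) θ = deriv u θ + t * deriv v θ :=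
        (h1.hasDerivAt.add (h2.hasDerivAt.const_mul t)).deriv
      simp only [jetAt, z, this, add_smul_apply]
    rw [hFt]
    exact hmain.2
  · filter_upwards [hs] with t ht
    refine (aestronglyMeasurable_comp_of_contDiffAt (hzm t) ?_).restrict
    filter_upwards [hu] with θ hθ
    exact hg.contDiffAt _ (jetAt_mem hθ) _ (hdist t θ ht)
  · have h0 : AEStronglyMeasurable (fun θ => g (z 0 θ)) := by
      refine aestronglyMeasurable_comp_of_contDiffAt (hzm 0) ?_
      filter_upwards [hu] with θ hθ
      exact hg.contDiffAt _ (jetAt_mem hθ) _ (by rw [hz0, dist_self]; exact hδ.le)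
    refine (intervalIntegrable_const (c := Λ)).mono_fun h0.restrict ?_
    filter_upwards [ae_restrict_of_ae hu] with θ hθ
    rw [hz0]
    exact (hg.abs_le _ (jetAt_mem hθ)).trans (le_abs_self _)
  · have h1 : ∀ y, Measurable fun θ => fderiv ℝ g (z 0 θ) y := fun y =>
      (measurable_fderiv_apply_const ℝ g y).comp (hzm 0)
    exact (((h1 _).mul v.continuous.measurable).add
      ((h1 _).mul (measurable_deriv v))).aestronglyMeasurable
  · filter_upwards [hu] with θ hθ _ t ht
    have h1 := hg.norm_fderiv_le _ (jetAt_mem hθ) _ (hdist t θ ht)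
    have hΛ : 0 ≤ Λ := (norm_nonneg _).trans h1
    refine (norm_add_le _ _).trans ?_
    rw [norm_mul, norm_mul]
    gcongr
    · exact abs_fderiv_vert_u_le h1
    · exact hvB θ
    · exact abs_fderiv_vert_q_le h1
    · exact hdB θ
  · filter_upwards [hu] with θ hθ _ t ht
    exact hder θ hθ t ht

/-- Perturbations are available for `t > 0` only, so minimality gives the sign of a right derivative
rather than an equation. -/
theorem first_variation_nonneg {g : ℝ × ℝ × ℝ → ℝ} {u : W1inf} {Λ c δ : ℝ} (hδ : 0 < δ)
    (hg : UniformIntegrand g u Λ c δ) {r : W1inf → ℝ} (hr : ContDiffAt ℝ 1 r u) (v : W1inf)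
    (hmin : ∀ᶠ t : ℝ in 𝓝[>] 0, r u + ∫ θ in 0..(2 * π), g (jetAt u θ) ≤
      r (u + t • v) + ∫ θ in 0..(2 * π), g (jetAt (u + t • v : W1inf) θ)) :
    0 ≤ fderiv ℝ r u v + ∫ θ in 0..(2 * π), variationDensity g u v θ := by
  have h1 : HasDerivAt (fun t : ℝ => r (u + t • v)) (fderiv ℝ r u v) 0 := by
    have h2 : HasDerivAt (fun t : ℝ => u + t • v) v 0 := by
      simpa using ((hasDerivAt_id (0 : ℝ)).smul_const v).const_add u
    have h3 : HasFDerivAt r (fderiv ℝ r u) (u + (0 : ℝ) • v) := by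
      rw [zero_smul, add_zero]
      exact (hr.differentiableAt (by simp)).hasFDerivAt
    exact h3.comp_hasDerivAt 0 h2
  have h2 := (h1.add (hasDerivAt_integral_jet hδ hg v).2).hasDerivWithinAt (s := Ioi 0)
  refine ge_of_tendsto (hasDerivWithinAt_iff_tendsto_slope' self_notMem_Ioi |>.1 h2) ?_
  filter_upwards [hmin, self_mem_nhdsWithin] with t ht h0
  rw [slope_def_field]
  refine div_nonneg ?_ (by simpa using le_of_lt h0)
  simp only [Pi.add_apply, zero_smul, add_zero]
  linarith

/-! ### Mean oscillation of the slope on short arcs -/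

theorem intervalIntegrable_of_abs_le {f : ℝ → ℝ} {C : ℝ} (hm : Measurable f)
    (hC : ∀ᵐ x, |f x| ≤ C) (a b : ℝ) : IntervalIntegrable f volume a b := by
  refine (intervalIntegrable_const (c := C)).mono_fun hm.aestronglyMeasurable ?_
  filter_upwards [ae_restrict_of_ae hC] with x hx
  exact hx.trans (le_abs_self C)

theorem abs_inner_dir_sub_le (P : Plane) (θ ξ : ℝ) :
    |inner ℝ P (dir θ) - inner ℝ P (dir ξ)| ≤ ‖P‖ * |θ - ξ| :=
  convex_univ.norm_image_sub_le_of_norm_hasDerivWithin_le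
    (fun θ _ => (hasDerivAt_inner_dir P θ).hasDerivWithinAt)
    (fun θ _ => abs_inner_dir_le P (θ + π / 2)) (mem_univ ξ) (mem_univ θ)

theorem norm_le_abs_inner_dir_add (P : Plane) (θ : ℝ) :
    ‖P‖ ≤ |inner ℝ P (dir θ)| + |inner ℝ P (dir (θ + π / 2))| := by
  refine abs_le_of_sq_le_sq' ?_ (by positivity) |>.2
  have : ‖P‖ ^ 2 = inner ℝ P (dir θ) ^ 2 + inner ℝ P (dir (θ + π / 2)) ^ 2 := by
    rw [EuclideanSpace.norm_sq_eq, Fin.sum_univ_two, inner_dir, inner_dir,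
      Real.cos_add_pi_div_two, Real.sin_add_pi_div_two, Real.norm_eq_abs, Real.norm_eq_abs, sq_abs,
      sq_abs]
    linear_combination -(P 0 ^ 2 + P 1 ^ 2) * Real.sin_sq_add_cos_sq θ
  rw [this, ← sq_abs (inner ℝ P (dir θ)), ← sq_abs (inner ℝ P (dir (θ + π / 2)))]
  nlinarith [abs_nonneg (inner ℝ P (dir θ)), abs_nonneg (inner ℝ P (dir (θ + π / 2)))]

theorem abs_slope_le {h : ℝ → ℝ} {K : ℝ≥0} (hK : LipschitzWith K h) {α β : ℝ} (hαβ : α < β) :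
    |(h β - h α) / (β - α)| ≤ K := by
  rw [abs_div, abs_of_pos (sub_pos.2 hαβ)]
  refine div_le_of_le_mul₀ (sub_nonneg.2 hαβ.le) K.2 ?_
  have := hK.dist_le_mul β α
  rwa [Real.dist_eq, Real.dist_eq, abs_of_pos (sub_pos.2 hαβ)] at this

/-- The slope of the sinusoid through two points of the graph of a Lipschitz function is close to
the slope of the chord. -/
theorem abs_inner_corner_deriv_sub_slope_le {h : ℝ → ℝ} {K : ℝ≥0} {H : ℝ}
    (hK : LipschitzWith K h) (hH : ∀ x, |h x| ≤ H) {α β : ℝ} (hαβ : α < β) (hL : β - α ≤ 1 / 2)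
    {θ : ℝ} (hθ : θ ∈ Icc α β) :
    |inner ℝ (corner h α β) (dir (θ + π / 2)) - (h β - h α) / (β - α)| ≤
      2 * (H + K) * (β - α) := by
  have hpos : 0 < Real.sin (β - α) :=
    Real.sin_pos_of_pos_of_lt_pi (by linarith) (by linarith [Real.pi_gt_three])
  set P := corner h α β
  obtain ⟨ξ, hξ, hm⟩ := exists_hasDerivAt_eq_slope (fun θ => inner ℝ P (dir θ))
    (fun θ => inner ℝ P (dir (θ + π / 2))) hαβ
    (fun x _ => (hasDerivAt_inner_dir P x).continuousAt.continuousWithinAt)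
    (fun x _ => hasDerivAt_inner_dir P x)
  rw [inner_corner_left h hpos.ne', inner_corner_right h hpos.ne'] at hm
  -- At `ξ` the tangential coordinate of `P` is the chord slope, at most `K`. The normal one differs
  -- from `h α` by at most `‖P‖ (β - α) ≤ ‖P‖ / 2`, which is absorbed.
  have hP : ‖P‖ ≤ 2 * (H + K) := by
    have h1 := norm_le_abs_inner_dir_add P ξ
    have h2 := abs_inner_dir_sub_le P ξ α
    rw [hm] at h1
    rw [inner_corner_left h hpos.ne', abs_of_pos (sub_pos.2 hξ.1)] at h2
    have h3 : |inner ℝ P (dir ξ)| ≤ |inner ℝ P (dir ξ) - h α| + |h α| := by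
      simpa using abs_add_le (inner ℝ P (dir ξ) - h α) (h α)
    have h4 := abs_slope_le hK hαβ
    have h5 := hH α
    have h6 : ‖P‖ * (ξ - α) ≤ ‖P‖ * (1 / 2) :=
      mul_le_mul_of_nonneg_left (by linarith [hξ.2]) (norm_nonneg _)
    linarith
  rw [← hm]
  refine (abs_inner_dir_sub_le P _ _).trans ?_
  refine mul_le_mul hP ?_ (abs_nonneg _) ((norm_nonneg _).trans hP)
  rw [abs_le]
  constructor <;> linarith [hξ.1, hξ.2, hθ.1, hθ.2]

theorem integral_deriv_eq_sub_of_lipschitz {f : ℝ → ℝ} {K : ℝ≥0} (hf : LipschitzWith K f)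
    (a b : ℝ) : ∫ x in a..b, deriv f x = f b - f a :=
  hf.lipschitzOnWith.absolutelyContinuousOnInterval.integral_deriv_eq_sub

/-- The chord slope is the average of `h'`, which lies almost everywhere in this closed convex set.
-/
theorem slope_mem_slopeHull (h : W1inf) {α β : ℝ} (hαβ : α < β) :
    (h β - h α) / (β - α) ∈ slopeHull h := by
  obtain ⟨K, hK⟩ := h.exists_lipschitz
  have hi : IntervalIntegrable (deriv h) volume α β :=
    intervalIntegrable_of_abs_le (measurable_deriv h)
      (Eventually.of_forall fun x => norm_deriv_le_of_lipschitz hK) α β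
  have hmem := (convex_slopeHull h).set_average_mem (μ := volume) (t := Ioc α β) (f := deriv h)
    isClosed_closure (by simp [hαβ]) (by simp)
    (ae_restrict_of_ae ((ae_differentiableAt h).mono fun x hx => deriv_mem_slopeHull hx))
    ((intervalIntegrable_iff_integrableOn_Ioc_of_le hαβ.le).1 hi)
  rwa [setAverage_eq, ← intervalIntegral.integral_of_le hαβ.le,
    integral_deriv_eq_sub_of_lipschitz hK, measureReal_def, Real.volume_Ioc,
    ENNReal.toReal_ofReal (sub_nonneg.2 hαβ.le), smul_eq_mul, inv_mul_eq_div] at hmem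

theorem fderiv_sub_vert_q_le {g : ℝ × ℝ × ℝ → ℝ} {u : W1inf} {Λ c δ : ℝ}
    (hg : UniformIntegrand g u Λ c δ) {z w : ℝ × ℝ × ℝ} (hz : z ∈ jetRange u)
    (hw : w ∈ jetRange u) :
    |fderiv ℝ g w (0, 0, 1) - fderiv ℝ g z (0, 0, 1)| ≤ Λ * ‖w - z‖ := by
  have := (fderiv ℝ g w - fderiv ℝ g z).le_opNorm (0, 0, 1)
  rw [norm_vert_q, mul_one] at this
  exact this.trans (hg.norm_fderiv_sub_le z hz w hw)

/-- Convexity of the integrand, in the form used against the first variation: here `x = h'(θ)`,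
`T` is the slope of the competitor, `m` the slope of the chord. -/
theorem fderiv_sub_mul_le {g : ℝ × ℝ × ℝ → ℝ} {u : W1inf} {Λ c δ : ℝ} {K : ℝ≥0} (hΛ : 0 ≤ Λ)
    (hg : UniformIntegrand g u Λ c δ) (hc : 0 ≤ c) (hK : LipschitzWith K u) {α θ L m x T E X : ℝ}
    (hθ : α ≤ θ) (hθL : θ - α ≤ L) (hm : m ∈ slopeHull u) (hx : x ∈ slopeHull u)
    (hT : |T - m| ≤ E) :
    (fderiv ℝ g (θ, u θ, x) (0, 0, 1) - fderiv ℝ g (α, u α, m) (0, 0, 1)) * (T - x) ≤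
      (Λ * E + Λ * ((1 + K) * L)) * |x - m| + Λ * ((1 + K) * L) * E
        - c * (2 * X * |x - m| - X ^ 2) := by
  set A := fderiv ℝ g (θ, u θ, x) (0, 0, 1)
  set B := fderiv ℝ g (θ, u θ, m) (0, 0, 1)
  set D := fderiv ℝ g (α, u α, m) (0, 0, 1)
  have h1 : c * (x - m) ^ 2 ≤ (A - B) * (x - m) := hg.monotone θ _ ⟨θ, rfl⟩ x hx m hm
  have h2 : |A - B| ≤ Λ * |x - m| := by
    have := fderiv_sub_vert_q_le hg (z := (θ, u θ, m)) (w := (θ, u θ, x))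
      (mem_jetRange.2 ⟨⟨θ, rfl⟩, hm⟩) (mem_jetRange.2 ⟨⟨θ, rfl⟩, hx⟩)
    simpa [Prod.norm_def] using this
  have h3 : |B - D| ≤ Λ * ((1 + K) * L) := by
    refine (fderiv_sub_vert_q_le hg (z := (α, u α, m)) (w := (θ, u θ, m))
      (mem_jetRange.2 ⟨⟨α, rfl⟩, hm⟩) (mem_jetRange.2 ⟨⟨θ, rfl⟩, hm⟩)).trans ?_
    refine mul_le_mul_of_nonneg_left ?_ hΛ
    have hd := hK.dist_le_mul θ α
    rw [Real.dist_eq, Real.dist_eq, abs_of_nonneg (sub_nonneg.2 hθ)] at hd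
    have hKL : (K : ℝ) * (θ - α) ≤ K * L := mul_le_mul_of_nonneg_left hθL K.2
    have hK0 : (0 : ℝ) ≤ K * L := mul_nonneg K.2 (by linarith)
    simp only [Prod.mk_sub_mk, sub_self, Prod.norm_def, Real.norm_eq_abs, abs_zero]
    refine max_le ?_ (max_le (by linarith) (by linarith))
    rw [abs_of_nonneg (sub_nonneg.2 hθ)]
    linarith
  have hE : 0 ≤ E := (abs_nonneg _).trans hT
  have e1 : (A - B) * (T - m) ≤ Λ * |x - m| * E :=
    (le_abs_self _).trans (by
      rw [abs_mul]; exact mul_le_mul h2 hT (abs_nonneg _) (by positivity))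
  have e2 : (B - D) * (T - x) ≤ Λ * ((1 + K) * L) * (E + |x - m|) := by
    refine (le_abs_self _).trans ?_
    rw [abs_mul]
    refine mul_le_mul h3 ?_ (abs_nonneg _) ((abs_nonneg _).trans h3)
    calc |T - x| = |(T - m) - (x - m)| := by ring_nf
      _ ≤ |T - m| + |x - m| := abs_sub _ _
      _ ≤ _ := by gcongr
  -- The square is replaced by its tangent line at `X`, linear in `|x - m|`. With `X` later chosen
  -- as the mean of `|h' - m|`, integration yields `c X²` per unit length, as Jensen's inequality
  -- would.
  have e3 : c * (2 * X * |x - m| - X ^ 2) ≤ c * (x - m) ^ 2 := by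
    refine mul_le_mul_of_nonneg_left ?_ hc
    rw [← sq_abs (x - m)]
    nlinarith [sq_nonneg (|x - m| - X)]
  -- The middle term carries the convexity; the other two are small because `T` is close to `m` and
  -- `θ` is close to `α`.
  have e4 : (A - D) * (T - x) = (A - B) * (T - m) - (A - B) * (x - m) + (B - D) * (T - x) := by
    ring
  rw [e4]
  linarith

/-- If `c X² ≤ a F (X + F)`-type bounds hold, then `X` is controlled by `F`. -/
theorem le_mul_of_sq_le {c a b X F : ℝ} (hc : 0 < c) (ha : 0 ≤ a) (hb : 0 ≤ b) (hF : 0 ≤ F)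
    (h : c * X ^ 2 ≤ a * F * X + b * F ^ 2) : X ≤ ((a + b) / c + 1) * F := by
  by_contra! hX
  have h1 : (a + b) / c * F + F < X := by linarith
  have h2 : 0 ≤ (a + b) / c * F := by positivity
  have hX0 : 0 < X := by linarith
  have hFX : F ≤ X := by linarith
  have h3 : c * X ^ 2 ≤ (a + b) * F * X := by
    have : b * F ^ 2 ≤ b * F * X := by
      rw [pow_two, ← mul_assoc]
      exact mul_le_mul_of_nonneg_left hFX (by positivity)
    linarith
  have h4 : c * X ≤ (a + b) * F := by
    refine le_of_mul_le_mul_right ?_ hX0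
    linarith
  have h5 : X ≤ (a + b) / c * F := by
    rw [div_mul_eq_mul_div, le_div_iff₀ hc]
    linarith
  linarith

/-- The integrand of the first variation at `h` in the direction `T - h` on `[α, β]`, where `T` is
the sinusoid with `T = h` at `α` and `β`. -/
def cornerDensity (g : ℝ × ℝ × ℝ → ℝ) (h ρ : ℝ → ℝ) (α β θ : ℝ) : ℝ :=
  (ρ θ + fderiv ℝ g (jetAt h θ) (0, 1, 0)) * (inner ℝ (corner h α β) (dir θ) - h θ) +
    fderiv ℝ g (jetAt h θ) (0, 0, 1) *
      (inner ℝ (corner h α β) (dir (θ + π / 2)) - deriv h θ)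

/-- The quantitative consequence of the first variation: on a short interval, the slope of `h` is
close in mean to the slope of the chord. -/
theorem exists_integral_abs_deriv_sub_slope_le {g : ℝ × ℝ × ℝ → ℝ} {h : W1inf} {Λ c δ : ℝ}
    (hΛ : 0 ≤ Λ) (hc : 0 < c) (hδ : 0 < δ) (hg : UniformIntegrand g h Λ c δ) {ρ : ℝ → ℝ}
    (hρ : ∀ a b, IntervalIntegrable ρ volume a b) :
    ∃ C : ℝ, 0 ≤ C ∧ ∀ α β, α < β → β - α ≤ 1 / 2 →
      0 ≤ ∫ θ in α..β, cornerDensity g h ρ α β θ →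
      ∫ θ in α..β, |deriv h θ - (h β - h α) / (β - α)| ≤
        C * (β - α) * ∫ θ in α..β, (|ρ θ| + 1) := by
  obtain ⟨K, hK⟩ := h.exists_lipschitz
  obtain ⟨H, hH⟩ := h.exists_bound
  have hH0 : 0 ≤ H := (norm_nonneg _).trans (hH 0)
  have hK0 : (0 : ℝ) ≤ K := K.2
  set B : ℝ := 2 * (H + K) with hB
  have hB0 : 0 ≤ B := by positivity
  set A₁ : ℝ := Λ * B + Λ * (1 + K) with hA₁
  set A₂ : ℝ := Λ * (1 + K) * B with hA₂
  have hA₁0 : 0 ≤ A₁ := by positivity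
  have hA₂0 : 0 ≤ A₂ := by positivity
  refine ⟨((1 + Λ) + A₁ + ((1 + Λ) * B + A₂)) / c + 1, by positivity,
    fun α β hαβ hL hvar => ?_⟩
  set L := β - α with hLdef
  have hL0 : 0 < L := sub_pos.2 hαβ
  set m := (h β - h α) / L with hm
  set P := corner h α β with hP
  set w : ℝ → ℝ := fun θ => |deriv h θ - m| with hw
  set W := ∫ θ in α..β, w θ with hW
  set X := W / L with hX
  have hWX : W = X * L := by rw [hX]; field_simp
  set FI := ∫ θ in α..β, (|ρ θ| + 1) with hFI
  have hpos : Real.sin (β - α) ≠ 0 := (Real.sin_pos_of_pos_of_lt_pi (by linarith)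
    (by linarith [Real.pi_gt_three])).ne'
  have hm_mem : m ∈ slopeHull h := slope_mem_slopeHull h hαβ
  have hdK : ∀ θ, |deriv h θ| ≤ K := fun θ => norm_deriv_le_of_lipschitz hK
  have hdm : Measurable (deriv h) := measurable_deriv h
  have hwi : ∀ a b, IntervalIntegrable w volume a b := by
    refine intervalIntegrable_of_abs_le (C := K + |m|) (hdm.sub_const m).abs ?_
    refine Eventually.of_forall fun θ => ?_
    rw [hw, abs_abs]
    exact (abs_sub _ _).trans (add_le_add_left (hdK θ) _)
  have hW0 : 0 ≤ W := intervalIntegral.integral_nonneg hαβ.le fun _ _ => abs_nonneg _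
  have hX0 : 0 ≤ X := by positivity
  have hT : ∀ θ ∈ Icc α β, |inner ℝ P (dir (θ + π / 2)) - m| ≤ B * L := fun θ hθ =>
    abs_inner_corner_deriv_sub_slope_le hK hH hαβ hL hθ
  set T' : ℝ → ℝ := fun θ => inner ℝ P (dir (θ + π / 2)) with hT'
  have hT'm : Measurable T' := by
    have : Continuous T' := by
      have h1 : Continuous fun θ => inner ℝ P (dir θ) :=
        continuous_iff_continuousAt.2 fun θ => (hasDerivAt_inner_dir P θ).continuousAt
      exact h1.comp (continuous_id.add continuous_const)
    exact this.measurable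
  set d : ℝ → ℝ := fun θ => T' θ - deriv h θ with hd
  have hdi : ∀ a b, IntervalIntegrable d volume a b := by
    refine intervalIntegrable_of_abs_le (C := ‖P‖ + K) (hT'm.sub hdm) ?_
    refine Eventually.of_forall fun θ => (abs_sub _ _).trans ?_
    exact add_le_add (abs_inner_dir_le P _) (hdK θ)
  set V : ℝ → ℝ := fun θ => inner ℝ P (dir θ) - h θ with hV
  obtain ⟨KT, hKT⟩ := lipschitz_inner_dir P
  have hVlip : LipschitzWith (KT + K) V := hKT.sub hK
  have hVd : ∀ᵐ θ, deriv V θ = d θ := by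
    filter_upwards [ae_differentiableAt h] with θ hθ
    exact ((hasDerivAt_inner_dir P θ).sub hθ.hasDerivAt).deriv
  have hVα : V α = 0 := by simp only [hV, hP, inner_corner_left h hpos, sub_self]
  have hVβ : V β = 0 := by simp only [hV, hP, inner_corner_right h hpos, sub_self]
  have hVint : ∀ x, ∫ θ in α..x, d θ = V x := fun x => by
    rw [← intervalIntegral.integral_congr_ae (hVd.mono fun θ h _ => h),
      integral_deriv_eq_sub_of_lipschitz hVlip, hVα, sub_zero]
  have hd_le : ∀ θ ∈ Icc α β, |d θ| ≤ B * L + w θ := fun θ hθ => by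
    calc |d θ| = |(T' θ - m) - (deriv h θ - m)| := by simp only [hd]; ring_nf
      _ ≤ |T' θ - m| + |deriv h θ - m| := abs_sub _ _
      _ ≤ _ := by gcongr; exact hT θ hθ
  have hV_le : ∀ θ ∈ Icc α β, |V θ| ≤ W + B * L ^ 2 := by
    intro θ hθ
    rw [← hVint θ]
    calc |∫ x in α..θ, d x| ≤ ∫ x in α..θ, |d x| :=
          intervalIntegral.abs_integral_le_integral_abs hθ.1
      _ ≤ ∫ x in α..β, |d x| := by
          refine intervalIntegral.integral_mono_interval le_rfl hθ.1 hθ.2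
            (Eventually.of_forall fun _ => abs_nonneg _) (hdi _ _).abs
      _ ≤ ∫ x in α..β, (B * L + w x) := by
          refine intervalIntegral.integral_mono_on hαβ.le (hdi _ _).abs
            (intervalIntegrable_const.add (hwi _ _)) hd_le
      _ = W + B * L ^ 2 := by
          rw [intervalIntegral.integral_add intervalIntegrable_const (hwi _ _),
            intervalIntegral.integral_const, smul_eq_mul]
          ring
  set Gu : ℝ → ℝ := fun θ => fderiv ℝ g (jetAt h θ) (0, 1, 0) with hGu
  set Gq : ℝ → ℝ := fun θ => fderiv ℝ g (jetAt h θ) (0, 0, 1) with hGq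
  set D : ℝ := fderiv ℝ g (α, h α, m) (0, 0, 1) with hD
  have hΛle : ∀ᵐ θ, ‖fderiv ℝ g (jetAt h θ)‖ ≤ Λ := by
    filter_upwards [ae_differentiableAt h] with θ hθ
    exact hg.norm_fderiv_le _ (jetAt_mem hθ) _ (by rw [dist_self]; exact hδ.le)
  have hGm : ∀ y, Measurable fun θ => fderiv ℝ g (jetAt h θ) y := fun y =>
    (measurable_fderiv_apply_const ℝ g y).comp (measurable_jetAt h)
  have hρG : ∀ a b, IntervalIntegrable (fun θ => (ρ θ + Gu θ) * V θ) volume a b := fun a b =>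
    ((hρ a b).add (intervalIntegrable_of_abs_le (hGm _)
      (hΛle.mono fun θ h => abs_fderiv_vert_u_le h) a b)).mul_continuousOn
      hVlip.continuous.continuousOn
  have hGd : ∀ a b, IntervalIntegrable (fun θ => Gq θ * d θ) volume a b := by
    refine intervalIntegrable_of_abs_le (C := Λ * (‖P‖ + K)) ((hGm _).mul (hT'm.sub hdm)) ?_
    filter_upwards [hΛle] with θ hθ
    rw [abs_mul]
    refine mul_le_mul (abs_fderiv_vert_q_le hθ) ((abs_sub _ _).trans ?_) (abs_nonneg _) hΛ
    exact add_le_add (abs_inner_dir_le P _) (hdK θ)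
  have hρa : IntervalIntegrable (fun θ => |ρ θ|) volume α β := (hρ α β).abs
  have hρ1 : IntervalIntegrable (fun θ => |ρ θ| + 1) volume α β :=
    hρa.add intervalIntegrable_const
  -- The summand `1` in `|ρ| + 1` allows powers of `L` to be absorbed into `FI`.
  have hLFI : L ≤ FI := by
    have h1 : ∫ θ in α..β, (1 : ℝ) = L := by simp [hLdef]
    rw [← h1]
    refine intervalIntegral.integral_mono_on hαβ.le intervalIntegrable_const hρ1 fun θ _ => ?_
    linarith [abs_nonneg (ρ θ)]
  have hFI0 : 0 ≤ FI := hL0.le.trans hLFI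
  -- As `V` vanishes at both ends, `G_q` may be shifted by the constant `D`, its value at the start
  -- of the arc and at the chord slope.
  have hzero : ∫ θ in α..β, D * d θ = 0 := by
    rw [intervalIntegral.integral_const_mul, hVint, hVβ, mul_zero]
  have hpoint : ∀ᵐ θ ∂volume.restrict (Icc α β), cornerDensity g h ρ α β θ - D * d θ ≤
      (|ρ θ| + 1) * ((1 + Λ) * (W + B * L ^ 2)) +
        ((A₁ * L - c * (2 * X)) * w θ + (A₂ * L ^ 2 + c * X ^ 2)) := by
    rw [ae_restrict_iff' measurableSet_Icc]
    filter_upwards [ae_differentiableAt h, hΛle] with θ hθ hle hmem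
    have e1 := fderiv_sub_mul_le (X := X) hΛ hg hc.le hK hmem.1 (by linarith [hmem.2] : θ - α ≤ L)
      hm_mem (deriv_mem_slopeHull hθ) (hT θ hmem)
    have e2 : (ρ θ + Gu θ) * V θ ≤ (|ρ θ| + 1) * ((1 + Λ) * (W + B * L ^ 2)) := by
      refine (le_abs_self _).trans ?_
      rw [abs_mul, ← mul_assoc]
      refine mul_le_mul ?_ (hV_le θ hmem) (abs_nonneg _) (by positivity)
      have h1 := abs_add_le (ρ θ) (Gu θ)
      have h2 : |Gu θ| ≤ Λ := abs_fderiv_vert_u_le hle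
      have h3 := mul_nonneg (abs_nonneg (ρ θ)) hΛ
      linarith
    have e3 : cornerDensity g h ρ α β θ - D * d θ =
        (ρ θ + Gu θ) * V θ + (Gq θ - D) * d θ := by
      simp only [cornerDensity, hGu, hGq, hd, hT', hV, hP]
      ring
    rw [e3]
    refine (add_le_add e2 e1).trans (le_of_eq ?_)
    simp only [hw, hA₁, hA₂]
    ring
  have hdens : IntervalIntegrable (fun θ => cornerDensity g h ρ α β θ) volume α β :=
    (hρG α β).add (hGd α β)
  have hint := intervalIntegral.integral_mono_ae_restrict hαβ.le (hdens.sub ((hdi α β).const_mul D))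
    ((hρ1.mul_const _).add (((hwi α β).const_mul _).add intervalIntegrable_const)) hpoint
  rw [intervalIntegral.integral_sub hdens ((hdi α β).const_mul D), hzero, sub_zero,
    intervalIntegral.integral_add (hρ1.mul_const _)
      (((hwi α β).const_mul _).add intervalIntegrable_const),
    intervalIntegral.integral_add ((hwi α β).const_mul _) intervalIntegrable_const,
    intervalIntegral.integral_mul_const, intervalIntegral.integral_const_mul,
    intervalIntegral.integral_const, smul_eq_mul] at hint
  have h0 := hvar.trans hint
  -- With `W = X L`, the integrated inequality becomes quadratic in the mean `X`, and solving it
  -- bounds `X` by a multiple of `FI`.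
  have h1 : c * X ^ 2 * L ≤ ((1 + Λ + A₁) * FI * X + ((1 + Λ) * B + A₂) * FI ^ 2) * L := by
    have i1 : FI * (B * L ^ 2) ≤ FI * (B * (FI * L)) := by
      rw [pow_two]
      gcongr
    have i2 : L * (A₁ * X * L) ≤ FI * (A₁ * X * L) := by gcongr
    have i3 : A₂ * L ^ 2 * L ≤ A₂ * FI ^ 2 * L := by gcongr
    have i4 := mul_le_mul_of_nonneg_left i1 (by positivity : 0 ≤ 1 + Λ)
    rw [← hW, ← hFI, ← hLdef, hWX] at h0
    linarith
  have h2 := le_mul_of_sq_le hc (by positivity) (by positivity) hFI0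
    (le_of_mul_le_mul_right h1 hL0)
  change W ≤ _
  rw [hWX]
  calc X * L ≤ (((1 + Λ) + A₁ + ((1 + Λ) * B + A₂)) / c + 1) * FI * L := by gcongr
    _ = _ := by ring

/-! ### Localization of the first variation to an arc -/

theorem MemLpPeriodic.intervalIntegrable {ρ : ℝ → ℝ} {p : ℝ≥0∞} (hp : 1 ≤ p)
    (h : MemLpPeriodic ρ p univ) (a b : ℝ) : IntervalIntegrable ρ volume a b := by
  refine h.1.intervalIntegrable₀ Real.two_pi_pos.ne' ?_ a b
  rw [intervalIntegrable_iff_integrableOn_Ioc_of_le Real.two_pi_pos.le]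
  have h2 := h.2
  rw [univ_inter] at h2
  exact h2.integrable hp

theorem integral_period_eq_of_eq_zero {f : ℝ → ℝ} (hf : Function.Periodic f (2 * π))
    (hi : ∀ a b, IntervalIntegrable f volume a b) {α β : ℝ} (hβ : β ≤ α + 2 * π)
    (hz : ∀ θ ∈ Ioo β (α + 2 * π), f θ = 0) :
    ∫ θ in 0..(2 * π), f θ = ∫ θ in α..β, f θ := by
  have h1 := hf.intervalIntegral_add_eq 0 α
  rw [zero_add] at h1
  rw [h1, ← intervalIntegral.integral_add_adjacent_intervals (hi α β) (hi β (α + 2 * π))]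
  have h2 : ∫ θ in β..(α + 2 * π), f θ = 0 := by
    refine intervalIntegral.integral_zero_ae ?_
    have : ∀ᵐ θ : ℝ, θ ≠ α + 2 * π := by simp [ae_iff, measure_singleton]
    filter_upwards [this] with θ hθ hmem
    rw [uIoc_of_le hβ] at hmem
    exact hz θ ⟨hmem.1, lt_of_le_of_ne hmem.2 hθ⟩
  rw [h2, add_zero]

theorem deriv_periodic {f : ℝ → ℝ} {T : ℝ} (hf : Function.Periodic f T) :
    Function.Periodic (deriv f) T := by
  intro x
  rw [← deriv_comp_add_const]
  congr 1
  exact funext hf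

theorem variationDensity_periodic {g : ℝ × ℝ × ℝ → ℝ}
    (hg : Function.Periodic g (2 * π, 0, 0)) (u v : W1inf) :
    Function.Periodic (variationDensity g u v) (2 * π) := by
  intro θ
  have h1 : jetAt u (θ + 2 * π) = jetAt u θ + (2 * π, 0, 0) := by
    simp [jetAt, u.periodic θ, deriv_periodic u.periodic θ]
  have h2 : fderiv ℝ g (jetAt u θ + (2 * π, 0, 0)) = fderiv ℝ g (jetAt u θ) := by
    rw [← fderiv_comp_add_right]
    congr 1
    exact funext hg
  rw [variationDensity, variationDensity, h1, h2, v.periodic, deriv_periodic v.periodic]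

theorem bump_corner_of_mem {Ω : Set Plane} {h : W1inf} (hs : IsShape Ω h) {α β θ : ℝ}
    (hαβ : α < β) (hπ : β - α < π) (hθ : θ ∈ Icc α β) :
    bump h (corner h α β) θ = inner ℝ (corner h α β) (dir θ) - h θ := by
  rw [bump_apply, max_eq_left]
  linarith [support_le_corner hs hαβ hπ hθ.1 hθ.2]

theorem bump_corner_of_notMem {Ω : Set Plane} {h : W1inf} (hs : IsShape Ω h) {α β θ : ℝ}
    (hαβ : α < β) (hπ : β - α < π) (hθ : θ ∈ Icc β (α + 2 * π)) :
    bump h (corner h α β) θ = 0 := by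
  rw [bump_apply, max_eq_right]
  linarith [corner_le_support hs hαβ hπ hθ.1 hθ.2]

/-- Over one period starting at `α`, the bump equals the sinusoid minus `h` on `[α, β]` and vanishes
on the rest, so the positive part leaves no trace in the integrals. -/
theorem integral_cornerDensity {Ω : Set Plane} {h : W1inf} (hs : IsShape Ω h)
    {g : ℝ × ℝ × ℝ → ℝ} {Λ c δ : ℝ} (hδ : 0 < δ) (hg : UniformIntegrand g h Λ c δ)
    (hgp : Function.Periodic g (2 * π, 0, 0)) {ρ : ℝ → ℝ} (hρp : Function.Periodic ρ (2 * π))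
    (hρ : ∀ a b, IntervalIntegrable ρ volume a b) {α β : ℝ} (hαβ : α < β) (hπ : β - α < π) :
    (∫ θ in 0..(2 * π), ρ θ * bump h (corner h α β) θ) +
      ∫ θ in 0..(2 * π), variationDensity g h (bump h (corner h α β)) θ =
    ∫ θ in α..β, cornerDensity g h ρ α β θ := by
  set v := bump h (corner h α β) with hv
  have hρv : ∀ a b, IntervalIntegrable (fun θ => ρ θ * v θ) volume a b := fun a b =>
    (hρ a b).mul_continuousOn v.continuous.continuousOn
  have hvar := variationDensity_periodic hgp h v
  have hvi : ∀ a b, IntervalIntegrable (variationDensity g h v) volume a b :=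
    hvar.intervalIntegrable₀ Real.two_pi_pos.ne' (hasDerivAt_integral_jet hδ hg v).1
  have hβ : β ≤ α + 2 * π := by linarith [Real.pi_pos]
  rw [integral_period_eq_of_eq_zero (fun θ => by rw [hρp θ, v.periodic θ]) hρv hβ,
    integral_period_eq_of_eq_zero hvar hvi hβ, ← intervalIntegral.integral_add (hρv α β) (hvi α β)]
  · refine intervalIntegral.integral_congr_ae ?_
    have hne : ∀ᵐ θ : ℝ, θ ≠ β := by simp [ae_iff, measure_singleton]
    filter_upwards [ae_differentiableAt h, hne] with θ hθ hβ hmem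
    rw [uIoc_of_le hαβ.le] at hmem
    have hIoo : θ ∈ Ioo α β := ⟨hmem.1, lt_of_le_of_ne hmem.2 hβ⟩
    have hd : deriv v θ = inner ℝ (corner h α β) (dir (θ + π / 2)) - deriv h θ := by
      rw [← ((hasDerivAt_inner_dir (corner h α β) θ).sub hθ.hasDerivAt).deriv]
      refine EventuallyEq.deriv_eq ?_
      filter_upwards [isOpen_Ioo.mem_nhds hIoo] with y hy
      exact bump_corner_of_mem hs hαβ hπ (Ioo_subset_Icc_self hy)
    rw [cornerDensity, variationDensity, hd, hv,
      bump_corner_of_mem hs hαβ hπ (Ioo_subset_Icc_self hIoo)]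
    ring
  · intro θ hθ
    have hd : deriv v θ = 0 := by
      have : v =ᶠ[𝓝 θ] fun _ => 0 := by
        filter_upwards [isOpen_Ioo.mem_nhds hθ] with y hy
        exact bump_corner_of_notMem hs hαβ hπ (Ioo_subset_Icc_self hy)
      rw [this.deriv_eq, deriv_const]
    rw [variationDensity, hd, hv, bump_corner_of_notMem hs hαβ hπ (Ioo_subset_Icc_self hθ),
      mul_zero, mul_zero, add_zero]
  · intro θ hθ
    rw [hv, bump_corner_of_notMem hs hαβ hπ (Ioo_subset_Icc_self hθ), mul_zero]

/-! ### From mean oscillation to absolute continuity of the derivative -/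

/-- A function whose increments over the middle halves of short intervals are controlled by
integrals over these intervals has increments controlled by integrals. -/
theorem sub_le_integral_of_middle_half {f F : ℝ → ℝ} {U : Set ℝ} {C ℓ₀ : ℝ} (hU : IsOpen U)
    (hℓ₀ : 0 < ℓ₀) (hF : ∀ a b, IntervalIntegrable F volume a b)
    (h : ∀ a ℓ, 0 < ℓ → ℓ ≤ ℓ₀ → Icc (a - ℓ / 2) (a + ℓ + ℓ / 2) ⊆ U →
      f (a + ℓ) - f a ≤ C * ∫ t in (a - ℓ / 2)..(a + ℓ + ℓ / 2), F t)
    {a b : ℝ} (hab : a < b) (hsub : Icc a b ⊆ U) :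
    f b - f a ≤ 2 * C * ∫ t in a..b, F t := by
  obtain ⟨δ, hδ, hthick⟩ := isCompact_Icc.exists_cthickening_subset_open hU hsub
  set Φ : ℝ → ℝ := fun x => ∫ t in a..x, F t with hΦ
  have hΦc : Continuous Φ := intervalIntegral.continuous_primitive hF a
  have hℓ : Tendsto (fun n : ℕ => (b - a) / (n + 1 : ℝ)) atTop (𝓝 0) := by
    simpa [div_eq_mul_inv] using
      (tendsto_one_div_add_atTop_nhds_zero_nat (𝕜 := ℝ)).const_mul (b - a)
  -- These are the total bounds for partitions into `n + 1` equal steps, each step being enlarged by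
  -- half its length on either side. The enlarged steps cover `[a, b]` twice, whence the factor `2`.
  have hlim : Tendsto (fun n : ℕ => C * ((Φ (b + (b - a) / (n + 1 : ℝ) / 2) -
      Φ (a + (b - a) / (n + 1 : ℝ) / 2)) + (Φ (b - (b - a) / (n + 1 : ℝ) / 2) -
      Φ (a - (b - a) / (n + 1 : ℝ) / 2)))) atTop (𝓝 (2 * C * ∫ t in a..b, F t)) := by
    have hc : Continuous fun s : ℝ => C * ((Φ (b + s / 2) - Φ (a + s / 2)) +
        (Φ (b - s / 2) - Φ (a - s / 2))) := by fun_prop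
    have := (hc.tendsto 0).comp hℓ
    refine this.trans (le_of_eq ?_)
    congr 1
    simp [hΦ]
    ring
  refine ge_of_tendsto hlim ?_
  filter_upwards [hℓ.eventually_lt_const (lt_min hℓ₀ hδ)] with n hn
  set ℓ := (b - a) / (n + 1 : ℝ) with hℓdef
  have hn0 : (0 : ℝ) < n + 1 := by positivity
  have hℓpos : 0 < ℓ := div_pos (sub_pos.2 hab) hn0
  have hnℓ : (n + 1 : ℝ) * ℓ = b - a := by rw [hℓdef]; field_simp
  -- The enlarged `i`-th step runs from index `i` to `i + 2` of `ψ`, so the sum splits into two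
  -- telescoping ones.
  set ψ : ℕ → ℝ := fun i => Φ (a + (i - 1 / 2 : ℝ) * ℓ) with hψ
  have hstep : ∀ i ∈ Finset.range (n + 1), f (a + (i + 1 : ℕ) * ℓ) - f (a + i * ℓ) ≤
      C * ((ψ (i + 2) - ψ (i + 1)) + (ψ (i + 1) - ψ i)) := by
    intro i hi
    have hi1 : (i : ℝ) + 1 ≤ n + 1 := by exact_mod_cast Finset.mem_range.1 hi
    have hi2 : ((i : ℝ) + 1) * ℓ ≤ b - a := by
      rw [← hnℓ]; exact mul_le_mul_of_nonneg_right hi1 hℓpos.le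
    have hi3 : 0 ≤ (i : ℝ) * ℓ := by positivity
    have h1 := h (a + i * ℓ) ℓ hℓpos (hn.le.trans (min_le_left _ _)) ?_
    · rw [← intervalIntegral.integral_interval_sub_left (hF a _) (hF a _)] at h1
      have e0 : a + ((i + 1 : ℕ) : ℝ) * ℓ = a + i * ℓ + ℓ := by push_cast; ring
      have e1 : ψ (i + 2) = ∫ t in a..(a + i * ℓ + ℓ + ℓ / 2), F t := by
        simp only [hψ, hΦ]; congr 1; push_cast; ring
      have e2 : ψ i = ∫ t in a..(a + i * ℓ - ℓ / 2), F t := by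
        simp only [hψ, hΦ]; congr 1; ring
      rw [e0, e1, e2]
      refine h1.trans (le_of_eq ?_)
      ring
    · refine Subset.trans (fun x hx => ?_) hthick
      have hℓδ : ℓ < δ := hn.trans_le (min_le_right _ _)
      refine Metric.mem_cthickening_of_dist_le x (max a (min x b)) δ _
        ⟨le_max_left _ _, max_le hab.le (min_le_right _ _)⟩ ?_
      rw [Real.dist_eq]
      rcases le_total x a with h1 | h1
      · rw [min_eq_left (h1.trans hab.le), max_eq_left h1, abs_le]
        constructor <;> linarith [hx.1]
      · rcases le_total x b with h2 | h2
        · rw [min_eq_left h2, max_eq_right h1, sub_self, abs_zero]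
          exact hδ.le
        · rw [min_eq_right h2, max_eq_right hab.le, abs_le]
          constructor <;> linarith [hx.2]
  have hsum := Finset.sum_le_sum hstep
  rw [Finset.sum_range_sub (fun i : ℕ => f (a + i * ℓ)), ← Finset.mul_sum,
    Finset.sum_add_distrib, Finset.sum_range_sub ψ,
    Finset.sum_range_sub (fun i => ψ (i + 1))] at hsum
  have e0 : a + ((n + 1 : ℕ) : ℝ) * ℓ = b := by push_cast; linarith
  have e1 : ψ (n + 1 + 1) = Φ (b + ℓ / 2) := by
    simp only [hψ]; congr 1; push_cast; linarith
  have e2 : ψ (n + 1) = Φ (b - ℓ / 2) := by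
    simp only [hψ]; congr 1; push_cast; linarith
  have e3 : ψ (0 + 1) = Φ (a + ℓ / 2) := by
    simp only [hψ]; congr 1; push_cast; ring
  have e4 : ψ 0 = Φ (a - ℓ / 2) := by
    simp only [hψ]; congr 1; push_cast; ring
  rw [e0, e1, e2, e3, e4] at hsum
  simpa using hsum

/-- Mean oscillation controls the increment of a monotone function over the middle half. -/
theorem middle_half_le_of_mean_oscillation {f : ℝ → ℝ} (hf : Monotone f) {a ℓ s E : ℝ}
    (hℓ : 0 < ℓ)
    (h : ∫ t in (a - ℓ / 2)..(a + ℓ + ℓ / 2), |f t - s| ≤ E) :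
    ℓ / 2 * (f (a + ℓ) - f a) ≤ E := by
  have hi : ∀ x y, IntervalIntegrable (fun t => |f t - s|) volume x y := fun x y =>
    (hf.intervalIntegrable.sub intervalIntegrable_const).abs
  -- By monotonicity `f ≤ f a` on the left quarter and `f ≥ f (a + ℓ)` on the right quarter; adding
  -- the two bounds eliminates `s`.
  have h1 : ℓ / 2 * (s - f a) ≤ ∫ t in (a - ℓ / 2)..a, |f t - s| := by
    have : ∫ _ in (a - ℓ / 2)..a, (s - f a) = ℓ / 2 * (s - f a) := by
      rw [intervalIntegral.integral_const, smul_eq_mul]; ring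
    rw [← this]
    refine intervalIntegral.integral_mono_on (by linarith) intervalIntegrable_const (hi _ _) ?_
    intro t ht
    have := hf ht.2
    have := neg_le_abs (f t - s)
    linarith
  have h2 : ℓ / 2 * (f (a + ℓ) - s) ≤ ∫ t in (a + ℓ)..(a + ℓ + ℓ / 2), |f t - s| := by
    have : ∫ _ in (a + ℓ)..(a + ℓ + ℓ / 2), (f (a + ℓ) - s) = ℓ / 2 * (f (a + ℓ) - s) := by
      rw [intervalIntegral.integral_const, smul_eq_mul]; ring
    rw [← this]
    refine intervalIntegral.integral_mono_on (by linarith) intervalIntegrable_const (hi _ _) ?_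
    intro t ht
    have := hf ht.1
    have := le_abs_self (f t - s)
    linarith
  have h3 : 0 ≤ ∫ t in a..(a + ℓ), |f t - s| :=
    intervalIntegral.integral_nonneg (by linarith) fun _ _ => abs_nonneg _
  rw [← intervalIntegral.integral_add_adjacent_intervals (hi _ a) (hi a _),
    ← intervalIntegral.integral_add_adjacent_intervals (hi a (a + ℓ)) (hi (a + ℓ) _)] at h
  linarith

/-- From the mean estimate for the slope on short intervals inside `U` to absolute continuity of the
derivative on `U`, for a semiconvex function. -/
theorem exists_deriv_sub_le_integral {h : W1inf} {M C : ℝ} (hM : 0 ≤ M)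
    (hconv : ConvexOn ℝ univ fun θ => h θ + M * (θ ^ 2 / 2)) {U : Set ℝ} (hU : IsOpen U)
    {F : ℝ → ℝ} (hF1 : ∀ θ, 1 ≤ F θ) (hFi : ∀ a b, IntervalIntegrable F volume a b) (hC : 0 ≤ C)
    (hmean : ∀ α β, α < β → β - α ≤ 1 / 2 → Icc α β ⊆ U →
      ∫ θ in α..β, |deriv h θ - (h β - h α) / (β - α)| ≤ C * (β - α) * ∫ θ in α..β, F θ) :
    ∃ C' : ℝ, 0 ≤ C' ∧ (∀ x ∈ U, DifferentiableAt ℝ h x) ∧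
      ∀ x y, x ≤ y → Icc x y ⊆ U → |deriv h y - deriv h x| ≤ ∫ t in x..y, C' * F t := by
  obtain ⟨K, hK⟩ := h.exists_lipschitz
  set c : ℝ → ℝ := fun θ => h θ + M * (θ ^ 2 / 2) with hc
  -- The right derivative is defined at every point and monotone, and almost everywhere equals `h' +
  -- M θ`.
  set f : ℝ → ℝ := fun θ => derivWithin c (Ioi θ) θ with hf
  have hmono : Monotone f := by
    have := hconv.monotoneOn_rightDeriv
    rwa [interior_univ, monotoneOn_univ] at this
  have hsq : ∀ θ : ℝ, HasDerivAt (fun θ : ℝ => M * (θ ^ 2 / 2)) (M * θ) θ := fun θ => by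
    simpa using ((hasDerivAt_pow 2 θ).div_const 2).const_mul M
  have hfd : ∀ᵐ θ, deriv h θ = f θ - M * θ := by
    filter_upwards [ae_differentiableAt h] with θ hθ
    have h1 : HasDerivAt c (deriv h θ + M * θ) θ := hθ.hasDerivAt.add (hsq θ)
    rw [hf]
    simp only [h1.hasDerivWithinAt.derivWithin (uniqueDiffWithinAt_Ioi θ)]
    ring
  have hdi : ∀ a b, IntervalIntegrable (deriv h) volume a b :=
    intervalIntegrable_of_abs_le (measurable_deriv h)
      (Eventually.of_forall fun x => norm_deriv_le_of_lipschitz hK)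
  have hlen : ∀ a b, a ≤ b → b - a ≤ ∫ t in a..b, F t := by
    intro a b hab
    have h1 : ∫ θ in a..b, (1 : ℝ) = b - a := by simp
    rw [← h1]
    exact intervalIntegral.integral_mono_on hab intervalIntegrable_const (hFi a b)
      fun θ _ => hF1 θ
  have hmid : ∀ a ℓ, 0 < ℓ → ℓ ≤ 1 / 4 → Icc (a - ℓ / 2) (a + ℓ + ℓ / 2) ⊆ U →
      f (a + ℓ) - f a ≤ 4 * (C + M) * ∫ t in (a - ℓ / 2)..(a + ℓ + ℓ / 2), F t := by
    intro a ℓ hℓ hℓ4 hsub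
    set α := a - ℓ / 2 with hα
    set β := a + ℓ + ℓ / 2 with hβ
    have hlenℓ : β - α = 2 * ℓ := by rw [hα, hβ]; ring
    have hαβ : α < β := by linarith
    have h1 := hmean α β hαβ (by linarith) hsub
    set m := (h β - h α) / (β - α)
    set FI := ∫ t in α..β, F t
    -- Freezing the linear term at `a` costs at most `M * (2 * ℓ)`, which is absorbed because `F ≥
    -- 1`.
    have h2 : ∫ t in α..β, |f t - (m + M * a)| ≤ ∫ t in α..β, (|deriv h t - m| + M * (2 * ℓ)) := by
      have hi1 : IntervalIntegrable (fun t => |f t - (m + M * a)|) volume α β :=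
        (hmono.intervalIntegrable.sub intervalIntegrable_const).abs
      have hi2 : IntervalIntegrable (fun t => |deriv h t - m| + M * (2 * ℓ)) volume α β :=
        ((hdi α β).sub intervalIntegrable_const).abs.add intervalIntegrable_const
      refine intervalIntegral.integral_mono_ae_restrict hαβ.le hi1 hi2 ?_
      rw [EventuallyLE, ae_restrict_iff' measurableSet_Icc]
      filter_upwards [hfd] with t ht hmem
      have e : f t - (m + M * a) = (deriv h t - m) + M * (t - a) := by rw [ht]; ring
      rw [e]
      refine (abs_add_le _ _).trans ?_
      gcongr
      rw [abs_mul, abs_of_nonneg hM]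
      gcongr
      rw [abs_le]
      constructor <;> linarith [hmem.1, hmem.2]
    rw [intervalIntegral.integral_add ((hdi α β).sub intervalIntegrable_const).abs
      intervalIntegrable_const, intervalIntegral.integral_const, smul_eq_mul] at h2
    have h3 := middle_half_le_of_mean_oscillation hmono hℓ h2
    have h4 : 2 * ℓ ≤ FI := hlenℓ ▸ hlen α β hαβ.le
    have h5 : (β - α) * (M * (2 * ℓ)) ≤ 2 * ℓ * (M * FI) := by
      rw [hlenℓ]
      gcongr
    rw [hlenℓ] at h1
    refine le_of_mul_le_mul_left ?_ (half_pos hℓ)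
    linarith
  have hfsub : ∀ x y, x ≤ y → Icc x y ⊆ U → f y - f x ≤ 2 * (4 * (C + M)) * ∫ t in x..y, F t := by
    intro x y hxy hsub
    rcases hxy.eq_or_lt with rfl | hxy
    · simp
    · exact sub_le_integral_of_middle_half hU (by norm_num) hFi hmid hxy hsub
  have hfc : ∀ x ∈ U, ContinuousAt f x := fun x hx =>
    continuousAt_of_abs_sub_le_integral (F := fun t => 2 * (4 * (C + M)) * F t) hU
      (fun a b => (hFi a b).const_mul _) (fun x y hxy hsub => by
        rw [abs_of_nonneg (sub_nonneg.2 (hmono hxy)), intervalIntegral.integral_const_mul]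
        exact hfsub x y hxy hsub) hx
  -- `h` is a primitive of `f - M θ`, and `f` is continuous on `U`, so `h` is differentiable at
  -- every point of `U`, not only almost everywhere.
  have hder : ∀ x ∈ U, HasDerivAt h (f x - M * x) x := by
    intro x hx
    have hi : ∀ a b, IntervalIntegrable (fun t => f t - M * t) volume a b := fun a b =>
      hmono.intervalIntegrable.sub ((continuous_const.mul continuous_id).intervalIntegrable a b)
    have hm : Measurable fun t => f t - M * t :=
      hmono.measurable.sub (measurable_id.const_mul M)
    have h1 := (intervalIntegral.integral_hasDerivAt_right (hi 0 x)
      (hm.stronglyMeasurable.stronglyMeasurableAtFilter)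
      ((hfc x hx).sub (continuousAt_const.mul continuousAt_id))).const_add (h 0)
    refine h1.congr_of_eventuallyEq (Eventually.of_forall fun y => ?_)
    have h2 := integral_deriv_eq_sub_of_lipschitz hK 0 y
    rw [intervalIntegral.integral_congr_ae (hfd.mono fun θ h _ => h)] at h2
    simp only [h2]
    ring
  refine ⟨2 * (4 * (C + M)) + M, by positivity, fun x hx => (hder x hx).differentiableAt,
    fun x y hxy hsub => ?_⟩
  rw [(hder y (hsub ⟨hxy, le_rfl⟩)).deriv, (hder x (hsub ⟨le_rfl, hxy⟩)).deriv,
    intervalIntegral.integral_const_mul]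
  have h1 := hfsub x y hxy hsub
  have h2 := mul_le_mul_of_nonneg_left (hlen x y hxy) hM
  have h3 := mul_nonneg hM (sub_nonneg.2 hxy)
  have h4 := hmono hxy
  rw [abs_le]
  constructor <;> linarith

/-! ### Sobolev regularity, contact points and admissibility -/

theorem isFiniteMeasure_restrict_period (U : Set ℝ) :
    IsFiniteMeasure (volume.restrict (U ∩ Ioc 0 (2 * π))) :=
  ⟨by
    rw [Measure.restrict_apply_univ]
    exact (measure_mono inter_subset_right).trans_lt measure_Ioc_lt_top⟩

theorem memW2p_of_deriv_sub_le {h : W1inf} {U : Set ℝ} (hU : IsOpen U) {p : ℝ≥0∞}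
    {F : ℝ → ℝ} (hF0 : ∀ θ, 0 ≤ F θ) (hFi : ∀ a b, IntervalIntegrable F volume a b)
    (hFp : MemLp F p (volume.restrict (U ∩ Ioc 0 (2 * π))))
    (hF : ∀ x y, x ≤ y → Icc x y ⊆ U → |deriv h y - deriv h x| ≤ ∫ t in x..y, F t) :
    MemW2p h p U := by
  obtain ⟨K, hK⟩ := h.exists_lipschitz
  obtain ⟨H, hH⟩ := h.exists_bound
  have hdK : ∀ θ, ‖deriv h θ‖ ≤ K := fun θ => norm_deriv_le_of_lipschitz hK
  have hfin := isFiniteMeasure_restrict_period U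
  refine ⟨⟨h.periodic, MemLp.of_bound h.continuous.aestronglyMeasurable H
    (Eventually.of_forall hH)⟩, deriv h, deriv (deriv h), ⟨deriv_periodic h.periodic,
    MemLp.of_bound (measurable_deriv h).aestronglyMeasurable K (Eventually.of_forall hdK)⟩,
    ⟨deriv_periodic (deriv_periodic h.periodic), ?_⟩, hasWeakDerivOn_deriv_of_lipschitzWith hK U,
    hasWeakDerivOn_of_abs_sub_le_integral hU hFi hF0 (measurable_deriv h) hdK hF⟩
  refine hFp.mono (measurable_deriv _).aestronglyMeasurable ?_
  rw [ae_restrict_iff' (hU.measurableSet.inter measurableSet_Ioc)]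
  filter_upwards [abs_deriv_le_of_abs_sub_le_integral hU hFi hF] with x hx hmem
  exact hx hmem.1

theorem isOpen_freeAngles {k₁ k₂ : ℝ → EReal} (hk₁ : UpperSemicontinuous k₁)
    (hk₂ : LowerSemicontinuous k₂) {h : ℝ → ℝ} (hh : Continuous h) :
    IsOpen (freeAngles k₁ k₂ h) := by
  have hE : Continuous fun θ => (h θ : EReal) := continuous_coe_real_ereal.comp hh
  rw [isOpen_iff_mem_nhds]
  rintro θ ⟨h1, h2⟩
  obtain ⟨d₁, hd₁, hd₁'⟩ := exists_between h1
  obtain ⟨d₂, hd₂, hd₂'⟩ := exists_between h2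
  filter_upwards [hk₁ θ d₁ hd₁, hk₂ θ d₂ hd₂', hE.continuousAt.eventually (lt_mem_nhds hd₁'),
    hE.continuousAt.eventually (gt_mem_nhds hd₂)] with x e1 e2 e3 e4
  exact ⟨e1.trans e3, e4.trans e2⟩

/-- Small increments of `h` keep the upper constraint on a compact set where it is not saturated. -/
theorem eventually_add_smul_le {k₂ : ℝ → EReal} (hk₂ : LowerSemicontinuous k₂) {h v : ℝ → ℝ}
    (hh : Continuous h) (hv : Continuous v) {s : Set ℝ} (hs : IsCompact s)
    (hlt : ∀ θ ∈ s, (h θ : EReal) < k₂ θ) :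
    ∀ᶠ t : ℝ in 𝓝 0, ∀ θ ∈ s, ((h θ + t * v θ : ℝ) : EReal) ≤ k₂ θ := by
  refine hs.eventually_forall_of_forall_eventually fun θ hθ => ?_
  obtain ⟨d, hd, hd'⟩ := exists_between (hlt θ hθ)
  have hE : Continuous fun z : ℝ × ℝ => ((h z.2 + z.1 * v z.2 : ℝ) : EReal) :=
    continuous_coe_real_ereal.comp (by fun_prop)
  have h1 : ∀ᶠ z : ℝ × ℝ in 𝓝 (0, θ), ((h z.2 + z.1 * v z.2 : ℝ) : EReal) < d :=
    hE.continuousAt.eventually (gt_mem_nhds (by simpa using hd))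
  have h2 : ∀ᶠ z : ℝ × ℝ in 𝓝 (0, θ), d < k₂ z.2 :=
    (continuous_snd.tendsto ((0 : ℝ), θ)).eventually (hk₂ θ d hd')
  filter_upwards [h1, h2] with z e1 e2
  exact (e1.trans e2).le

/-- If `x` lies on the supporting line, `h - ⟨x, e^{i·}⟩` has a minimum at `θ`, so `h'(θ)` is the
tangential coordinate of `x` while `h(θ)` is the normal one; together they determine `x`. Existence
is compactness of the closure of `Ω`. -/
theorem existsUnique_support_point {Ω : Set Plane} {h : W1inf} (hs : IsShape Ω h) {θ : ℝ}
    (hd : DifferentiableAt ℝ h θ) : ∃! x, x ∈ frontier Ω ∧ inner ℝ x (dir θ) = h θ := by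
  have hderiv : ∀ x ∈ frontier Ω, inner ℝ x (dir θ) = h θ →
      inner ℝ x (dir (θ + π / 2)) = deriv h θ := by
    intro x hx hxθ
    have hmin : IsLocalMin (fun φ => h φ - inner ℝ x (dir φ)) θ :=
      Eventually.of_forall fun φ => by
        simp only [hxθ, sub_self, sub_nonneg]
        exact inner_le_support hs (frontier_subset_closure hx) φ
    have := hmin.hasDerivAt_eq_zero (hd.hasDerivAt.sub (hasDerivAt_inner_dir x θ))
    linarith
  refine existsUnique_of_exists_of_unique ?_ fun x y hx hy => ?_
  · obtain ⟨M, hM⟩ := h.exists_bound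
    have hbdd : Bornology.IsBounded Ω := by
      refine (Metric.isBounded_closedBall (x := (0 : Plane)) (r := M)).subset fun x hx => ?_
      rw [mem_closedBall_zero_iff]
      obtain ⟨φ, hφ⟩ := exists_dir_eq x
      rw [← hφ]
      exact (inner_le_support hs (subset_closure hx) φ).trans ((le_abs_self _).trans (hM φ))
    obtain ⟨x, hx, hmax⟩ := hbdd.isCompact_closure.exists_isMaxOn hs.nonempty.closure
      (f := fun x : Plane => inner ℝ x (dir θ)) (by fun_prop)
    have hxθ : inner ℝ x (dir θ) = h θ := by
      refine le_antisymm (inner_le_support hs hx θ) ((hs.isLUB θ).2 ?_)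
      rintro _ ⟨y, hy, rfl⟩
      exact hmax (subset_closure hy)
    refine ⟨x, ?_, hxθ⟩
    rw [hs.isOpen.frontier_eq]
    refine ⟨hx, fun hxΩ => ?_⟩
    -- A maximizer inside the open set could be moved along `e^{iθ}`, exceeding the maximum.
    have hcont : Tendsto (fun t : ℝ => x + t • dir θ) (𝓝[>] 0) (𝓝 x) := by
      have : Continuous fun t : ℝ => x + t • dir θ := by fun_prop
      simpa using (this.tendsto 0).mono_left nhdsWithin_le_nhds
    obtain ⟨t, htΩ, ht⟩ := ((hcont.eventually (hs.isOpen.mem_nhds hxΩ)).and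
      self_mem_nhdsWithin).exists
    have h1 := inner_le_support hs (subset_closure htΩ) θ
    rw [inner_add_left, real_inner_smul_left, hxθ, real_inner_self_eq_norm_sq, norm_dir] at h1
    have : (0 : ℝ) < t := ht
    linarith
  · have h1 := norm_le_abs_inner_dir_add (x - y) θ
    rw [inner_sub_left, inner_sub_left, hx.2, hy.2, hderiv x hx.1 hx.2, hderiv y hy.1 hy.2,
      sub_self, sub_self, abs_zero, add_zero] at h1
    exact sub_eq_zero.1 (norm_le_zero_iff.1 h1)

/-- A supporting line through the midpoint contains both ends of the segment, since neither end lies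
beyond it; uniqueness of the contact point then identifies them. -/
theorem eq_of_segment_subset_boundaryPart {Ω : Set Plane} {h : W1inf} (hs : IsShape Ω h)
    {U : Set ℝ} (hU : ∀ θ ∈ U, DifferentiableAt ℝ h θ) {x y : Plane}
    (hxy : segment ℝ x y ⊆ boundaryPart Ω h U) : x = y := by
  obtain ⟨-, θ, hθ, hmid⟩ := hxy (midpoint_mem_segment x y)
  have hx := (hxy (left_mem_segment ℝ x y)).1
  have hy := (hxy (right_mem_segment ℝ x y)).1
  have h1 := inner_le_support hs (frontier_subset_closure hx) θ
  have h2 := inner_le_support hs (frontier_subset_closure hy) θ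
  rw [midpoint_eq_smul_add, real_inner_smul_left, inner_add_left, invOf_eq_inv] at hmid
  exact (existsUnique_support_point hs (hU θ hθ)).unique ⟨hx, by linarith⟩ ⟨hy, by linarith⟩

/-- The first variation of the optimal shape in the direction of a corner over a free arc. -/
theorem optimal_variation_nonneg {S : Set (Set Plane)} {J R C : Set Plane → ℝ}
    (hJ : ∀ Ω ∈ S, J Ω = R Ω + C Ω) {k₁ k₂ : ℝ → EReal}
    (hk₂ : Function.Periodic k₂ (2 * π)) (hk₂' : LowerSemicontinuous k₂)
    (hF : admissible S =
      {h : W1inf | (∃ Ω, IsShape Ω h) ∧ ∀ θ, k₁ θ ≤ (h θ : EReal) ∧ (h θ : EReal) ≤ k₂ θ})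
    {Ω₀ : Set Plane} {h₀ : W1inf} (hshape : IsShape Ω₀ h₀) (hopt : IsOptimalShape J S Ω₀)
    {r : W1inf → ℝ} {G : ℝ → ℝ → ℝ → ℝ}
    (hR : ∀ Ω ∈ S, ∀ h : W1inf, IsShape Ω h → R Ω = r h)
    (hC : ∀ Ω ∈ S, ∀ h : W1inf, IsShape Ω h →
      C Ω = ∫ θ in 0..(2 * π), G θ (h θ) (deriv h θ))
    (hr : ContDiffAt ℝ 1 r h₀) {Λ c δ : ℝ} (hδ : 0 < δ)
    (hg : UniformIntegrand (fun z => G z.1 z.2.1 z.2.2) h₀ Λ c δ) {α β : ℝ} (hαβ : α < β)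
    (hπ : β - α < π) (hfree : Icc α β ⊆ freeAngles k₁ k₂ h₀) :
    0 ≤ fderiv ℝ r h₀ (bump h₀ (corner h₀ α β)) + ∫ θ in 0..(2 * π),
      variationDensity (fun z => G z.1 z.2.1 z.2.2) h₀ (bump h₀ (corner h₀ α β)) θ := by
  set v := bump h₀ (corner h₀ α β) with hv
  have hadm : h₀ ∈ admissible S := ⟨Ω₀, hopt.1, hshape⟩
  rw [hF] at hadm
  refine first_variation_nonneg hδ hg hr v ?_
  have hup := eventually_add_smul_le hk₂' h₀.continuous v.continuous (isCompact_Icc (a := α)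
    (b := β)) fun θ hθ => (hfree hθ).2
  filter_upwards [nhdsWithin_le_nhds hup, nhdsWithin_le_nhds (gt_mem_nhds one_pos),
    self_mem_nhdsWithin] with t ht ht1 ht0
  have ht0 : 0 < t := ht0
  have hmem : h₀ + t • v ∈ admissible S := by
    rw [hF]
    refine ⟨⟨_, isShape_add_smul_bump hshape _ ht0.le ht1⟩, fun θ => ?_⟩
    rw [add_smul_apply]
    constructor
    · refine (hadm.2 θ).1.trans (EReal.coe_le_coe_iff.2 (le_add_of_nonneg_right ?_))
      exact mul_nonneg ht0.le (le_max_right _ _)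
    -- The angle is brought into `[α, α + 2π)`, where the upper constraint either holds by
    -- compactness of the free arc or is that of `h₀`, as `v` vanishes there.
    · obtain ⟨n, hn, -⟩ := existsUnique_sub_zsmul_mem_Ico Real.two_pi_pos θ α
      rw [← h₀.periodic.sub_zsmul_eq n, ← v.periodic.sub_zsmul_eq n, ← hk₂.sub_zsmul_eq n]
      rcases le_total (θ - n • (2 * π)) β with hle | hle
      · exact ht _ ⟨hn.1, hle⟩
      · rw [hv, bump_corner_of_notMem hshape hαβ hπ ⟨hle, hn.2.le⟩, mul_zero, add_zero]
        exact (hadm.2 _).2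
  obtain ⟨Ω, hΩ, hΩs⟩ := hmem
  have hle := hopt.2.2 Ω hΩ hΩs.convex
  rw [hJ Ω hΩ, hJ Ω₀ hopt.1, hR Ω hΩ _ hΩs, hR Ω₀ hopt.1 _ hshape, hC Ω hΩ _ hΩs,
    hC Ω₀ hopt.1 _ hshape] at hle
  exact hle

end SupportShape

end

theorem corollary3p8
    -- the class of admissible open sets, and the functional `J = R + C` on it
    (S : Set (Set Plane)) (hS : ∀ Ω ∈ S, IsOpen Ω)
    (J R C : Set Plane → ℝ) (hJ : ∀ Ω ∈ S, J Ω = R Ω + C Ω)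
    -- the admissible support functions are those lying between `k₁` and `k₂`
    (k₁ k₂ : ℝ → EReal)
    (hk₁ : Function.Periodic k₁ (2 * π)) (hk₂ : Function.Periodic k₂ (2 * π))
    (hk₁' : UpperSemicontinuous k₁) (hk₂' : LowerSemicontinuous k₂)
    (hF : admissible S =
      {h : W1inf | (∃ Ω, IsShape Ω h) ∧ ∀ θ, k₁ θ ≤ (h θ : EReal) ∧ (h θ : EReal) ≤ k₂ θ})
    -- the optimal shape
    (Ω₀ : Set Plane) (h₀ : W1inf) (hshape : IsShape Ω₀ h₀) (hopt : IsOptimalShape J S Ω₀)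
    -- `R` and `C` in terms of the support function
    (p : ℝ≥0∞) (hp : 1 ≤ p)
    (r : W1inf → ℝ) (G : ℝ → ℝ → ℝ → ℝ)
    (hR : ∀ Ω ∈ S, ∀ h : W1inf, IsShape Ω h → R Ω = r h)
    (hC : ∀ Ω ∈ S, ∀ h : W1inf, IsShape Ω h →
      C Ω = ∫ θ in 0..(2 * π), G θ (h θ) (deriv h θ))
    (hr : RegularPart r h₀ p) (hG : ConvexIntegrand G h₀) :
    MemW2p h₀ p (freeAngles k₁ k₂ h₀) ∧
      -- strict convexity: the supporting lines with free normal touch `∂Ω₀` at one point only,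
      -- and the free boundary contains no nontrivial segment
      (∀ θ ∈ freeAngles k₁ k₂ h₀, ∃! x, x ∈ frontier Ω₀ ∧ inner ℝ x (dir θ) = h₀ θ) ∧
      (∀ x y : Plane,
        segment ℝ x y ⊆ boundaryPart Ω₀ h₀ (freeAngles k₁ k₂ h₀) → x = y) := by
  obtain ⟨hr1, ρ, hρ, hρr⟩ := hr
  obtain ⟨Λ, c, δ, hΛ, hc, hδ, hg⟩ := exists_uniformIntegrand hG
  have hρi := hρ.intervalIntegrable hp
  have hgp : Function.Periodic (fun z : ℝ × ℝ × ℝ => G z.1 z.2.1 z.2.2) (2 * π, 0, 0) :=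
    fun z => by simp [hG.1]
  have hU := isOpen_freeAngles hk₁' hk₂' h₀.continuous
  set U := freeAngles k₁ k₂ h₀ with hUdef
  obtain ⟨M, hM, hconv⟩ := exists_semiconvex hshape
  obtain ⟨C₀, hC₀, hmean⟩ := exists_integral_abs_deriv_sub_slope_le hΛ hc hδ hg hρi
  have hFi : ∀ a b, IntervalIntegrable (fun θ => |ρ θ| + 1) volume a b := fun a b =>
    (hρi a b).abs.add intervalIntegrable_const
  obtain ⟨C', hC', hdiff, hsub⟩ := exists_deriv_sub_le_integral hM hconv hU
    (F := fun θ => |ρ θ| + 1) (fun θ => le_add_of_nonneg_left (abs_nonneg _)) hFi hC₀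
    fun α β hαβ hL hI => hmean α β hαβ hL (by
      have hπ : β - α < π := by linarith [Real.pi_gt_three]
      rw [← integral_cornerDensity hshape hδ hg hgp hρ.1 hρi hαβ hπ, ← hρr]
      exact optimal_variation_nonneg hJ hk₂ hk₂' hF hshape hopt hR hC hr1 hδ hg hαβ hπ hI)
  refine ⟨memW2p_of_deriv_sub_le hU (F := fun t => C' * (|ρ t| + 1))
    (fun θ => mul_nonneg hC' (by positivity)) (fun a b => (hFi a b).const_mul C') ?_ hsub,
    fun θ hθ => existsUnique_support_point hshape (hdiff θ hθ),
    fun x y hxy => eq_of_segment_subset_boundaryPart hshape hdiff hxy⟩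
  have hfin := isFiniteMeasure_restrict_period U
  have hρU : MemLp ρ p (volume.restrict (U ∩ Ioc 0 (2 * π))) :=
    hρ.2.mono_measure (Measure.restrict_mono (inter_subset_inter_left _ (subset_univ _)) le_rfl)
  exact (hρU.abs.add (memLp_const 1)).const_mul C'
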